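/- Let $k$ be a field of characteristic $0$, let $R=k[x_1,\dots,x_n]$ with its standard grading, let $\mathfrak m=(x_1,\dots,x_n)$, and let the symmetric group $\mathfrak S_n$ act on $R$ by permuting the variables. For a partition $\lambda$ of $n$ let $S^\lambda$ denote the Specht module over $k$ (so $S^{(n)}$ is the trivial, $S^{(1^n)}$ the alternating and $S^{(n-1,1)}$ the standard representation of $\mathfrak S_n$). Let $I\subseteq R$ be a nonzero homogeneous ideal that is stable under $\mathfrak S_n$ and is a complete intersection ideal, i.e. $I$ is generated by a regular sequence in $R$. Then the representation $I/\mathfrak m I$ of $\mathfrak S_n$ is isomorphic to one of the following: (I) $\bigoplus^m S^{(n)}$ with $1\le m\le n$; (II) $S^{(1^n)}\oplus\bigoplus^m S^{(n)}$ with $0\le m\le n-1$; (III) $S^{(n-1,1)}\oplus\bigoplus^m S^{(n)}$ with $0\le m\le 1$ (where $n\ge 2$); (IV) only for $n=4$: $S^{(2,2)}\oplus\bigoplus^m S^{(4)}$ with $0\le m\le 2$. -/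

import Mathlib

noncomputable section

namespace SymCI

open MvPolynomial

/-! ### The symmetric group acting on the polynomial ring -/

/-- The representation of `Perm (Fin n)` on `k[x₁, …, xₙ]` permuting the variables:
`σ` is the algebra automorphism with `x_i ↦ x_{σ i}`. -/
def polyRep (k : Type*) [Field k] (n : ℕ) :
    Representation k (Equiv.Perm (Fin n)) (MvPolynomial (Fin n) k) where
  toFun σ := (rename (R := k) σ).toLinearMap
  map_one' := by
    refine LinearMap.ext fun p => ?_
    simp
  map_mul' σ τ := by
    refine LinearMap.ext fun p => ?_
    simp [rename_rename, Equiv.Perm.coe_mul]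

/-- The irrelevant ideal `(x₁, …, xₙ)`. -/
def irrelevant (k : Type*) [Field k] (n : ℕ) : Ideal (MvPolynomial (Fin n) k) :=
  Ideal.span (Set.range X)

/-- An ideal is stable if permuting the variables maps it into itself. -/
def IsStable {k : Type*} [Field k] {n : ℕ} (I : Ideal (MvPolynomial (Fin n) k)) : Prop :=
  ∀ σ : Equiv.Perm (Fin n), ∀ f ∈ I, rename σ f ∈ I

/-- A homogeneous ideal, for the standard grading of `k[x₁, …, xₙ]`. -/
def IsHomogeneousIdeal {k : Type*} [Field k] {n : ℕ}
    (I : Ideal (MvPolynomial (Fin n) k)) : Prop :=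
  letI : GradedAlgebra (homogeneousSubmodule (Fin n) k) := gradedAlgebra
  I.IsHomogeneous (homogeneousSubmodule (Fin n) k)

/-- A complete intersection ideal: one generated by a regular sequence. -/
def IsCompleteIntersection {R : Type*} [CommRing R] (I : Ideal R) : Prop :=
  ∃ rs : List R, RingTheory.Sequence.IsRegular R rs ∧ Ideal.ofList rs = I

theorem irrelevant_isStable (k : Type*) [Field k] (n : ℕ) : IsStable (irrelevant k n) := by
  intro σ f hf
  have h : irrelevant k n ≤ (irrelevant k n).comap (rename (R := k) σ).toRingHom := by
    refine Ideal.span_le.2 ?_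
    rintro _ ⟨i, rfl⟩
    have : rename σ (X i : MvPolynomial (Fin n) k) ∈ irrelevant k n := by
      rw [rename_X]
      exact Ideal.subset_span ⟨σ i, rfl⟩
    exact this
  exact h hf

theorem IsStable.mul {k : Type*} [Field k] {n : ℕ} {I J : Ideal (MvPolynomial (Fin n) k)}
    (hI : IsStable I) (hJ : IsStable J) : IsStable (I * J) := by
  intro σ f hf
  have h : I * J ≤ (I * J).comap (rename (R := k) σ).toRingHom := by
    refine Ideal.mul_le.2 fun a ha b hb => ?_
    have : rename σ (a * b) ∈ I * J := by
      rw [map_mul]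
      exact Ideal.mul_mem_mul (hI σ a ha) (hJ σ b hb)
    exact this
  exact h hf

/-- The representation on a stable ideal `I`. -/
def idealRep {k : Type*} [Field k] {n : ℕ} (I : Ideal (MvPolynomial (Fin n) k))
    (hI : IsStable I) :
    Representation k (Equiv.Perm (Fin n)) (I.restrictScalars k) :=
  (polyRep k n).subrepresentation (I.restrictScalars k) fun σ f hf => hI σ f hf

/-- `𝔪 I` as a subspace of `I`. -/
def irrelevantMul {k : Type*} [Field k] {n : ℕ} (I : Ideal (MvPolynomial (Fin n) k)) :
    Submodule k (I.restrictScalars k) :=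
  ((irrelevant k n * I).restrictScalars k).comap (I.restrictScalars k).subtype

/-- The representation on `I / 𝔪 I` for a stable ideal `I`. -/
def genRep {k : Type*} [Field k] {n : ℕ} (I : Ideal (MvPolynomial (Fin n) k))
    (hI : IsStable I) :
    Representation k (Equiv.Perm (Fin n)) (I.restrictScalars k ⧸ irrelevantMul I) :=
  (idealRep I hI).quotient (irrelevantMul I) fun σ f hf =>
    (irrelevant_isStable k n).mul hI σ f.1 hf

/-! ### Specht modules -/

/-- The Young diagram of a partition; its rows are the parts in decreasing order. -/
def diagram {n : ℕ} (lam : n.Partition) : YoungDiagram :=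
  YoungDiagram.ofRowLens (lam.parts.sort (· ≥ ·)) (lam.parts.pairwise_sort (· ≥ ·)).sortedGE

/-- A Young tableau of shape `lam`: a bijective filling of the boxes with the `n` entries,
recorded as the map that sends an entry to its box `(row, column)`. -/
abbrev Tableau {n : ℕ} (lam : n.Partition) : Type :=
  Fin n ≃ (diagram lam).cells

namespace Tableau

/-- The row of an entry. -/
def row {n : ℕ} {lam : n.Partition} (T : Tableau lam) (i : Fin n) : ℕ := (T i).1.1

/-- The column of an entry. -/
def col {n : ℕ} {lam : n.Partition} (T : Tableau lam) (i : Fin n) : ℕ := (T i).1.2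

/-- The tableau `σ T`, with every entry `i` replaced by `σ i`. -/
def act {n : ℕ} {lam : n.Partition} (σ : Equiv.Perm (Fin n)) (T : Tableau lam) : Tableau lam :=
  (σ⁻¹ : Equiv.Perm (Fin n)).trans T

/-- `π` lies in the column stabilizer of `T`. -/
def StabilizesColumns {n : ℕ} {lam : n.Partition} (T : Tableau lam)
    (π : Equiv.Perm (Fin n)) : Prop :=
  ∀ i, T.col (π i) = T.col i

instance {n : ℕ} {lam : n.Partition} (T : Tableau lam) : DecidablePred T.StabilizesColumns :=
  fun _ => inferInstanceAs (Decidable (∀ _, _))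

end Tableau

/-- The permutation module on row assignments. The tabloid (row equivalence class) of a
tableau `T` is determined by, and identified with, the function `T.row` that gives the row of
each entry; `σ` maps a row assignment `r` to `r ∘ σ⁻¹`. -/
def tabloidRep (k : Type*) [Field k] (n : ℕ) :
    Representation k (Equiv.Perm (Fin n)) ((Fin n → ℕ) →₀ k) where
  toFun σ := Finsupp.lmapDomain k k fun r => r ∘ ⇑σ⁻¹
  map_one' := by
    refine LinearMap.ext fun v => ?_
    exact Finsupp.mapDomain_id (v := v)
  map_mul' σ τ := by
    refine LinearMap.ext fun v => ?_
    simp only [Module.End.mul_apply, Finsupp.lmapDomain_apply]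
    rw [← Finsupp.mapDomain_comp]
    congr 1

/-- The polytabloid of `T`: the sum of `sgn(π) π{T}` over the column stabilizer of `T`. -/
def polytabloid (k : Type*) [Field k] {n : ℕ} {lam : n.Partition} (T : Tableau lam) :
    (Fin n → ℕ) →₀ k :=
  ∑ π : Equiv.Perm (Fin n) with T.StabilizesColumns π,
    ((Equiv.Perm.sign π : ℤ) : k) • tabloidRep k n π (Finsupp.single T.row 1)

theorem tabloidRep_polytabloid (k : Type*) [Field k] {n : ℕ} {lam : n.Partition}
    (σ : Equiv.Perm (Fin n)) (T : Tableau lam) :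
    tabloidRep k n σ (polytabloid k T) = polytabloid k (T.act σ) := by
  have hrow : Finsupp.single (T.act σ).row (1 : k)
      = tabloidRep k n σ (Finsupp.single T.row 1) := by
    simp only [tabloidRep, MonoidHom.coe_mk, OneHom.coe_mk, Finsupp.lmapDomain_apply,
      Finsupp.mapDomain_single]
    rfl
  unfold polytabloid
  rw [map_sum]
  refine Finset.sum_bij (fun π _ => σ * π * σ⁻¹) ?_ ?_ ?_ ?_
  · intro π hπ
    simp only [Finset.mem_filter, Finset.mem_univ, true_and] at hπ ⊢
    intro i
    have := hπ (σ⁻¹ i)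
    simpa [Tableau.col, Tableau.act] using this
  · intro π _ τ _ h
    simpa using h
  · intro π hπ
    simp only [Finset.mem_filter, Finset.mem_univ, true_and] at hπ
    refine ⟨σ⁻¹ * π * σ, ?_, by group⟩
    simp only [Finset.mem_filter, Finset.mem_univ, true_and]
    intro i
    have := hπ (σ i)
    simpa [Tableau.col, Tableau.act] using this
  · intro π _
    rw [map_smul, hrow]
    have h1 : Equiv.Perm.sign (σ * π * σ⁻¹) = Equiv.Perm.sign π := by
      rw [Equiv.Perm.sign_mul, Equiv.Perm.sign_mul, Equiv.Perm.sign_inv, mul_right_comm,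
        Int.units_mul_self, one_mul]
    rw [h1, ← Module.End.mul_apply, ← Module.End.mul_apply, ← map_mul, ← map_mul]
    simp

/-- The underlying space of the Specht module `S^lam`: the span of all polytabloids. -/
def spechtSpace (k : Type*) [Field k] {n : ℕ} (lam : n.Partition) :
    Submodule k ((Fin n → ℕ) →₀ k) :=
  Submodule.span k (Set.range fun T : Tableau lam => polytabloid k T)

/-- The Specht module `S^lam`. -/
def specht (k : Type*) [Field k] {n : ℕ} (lam : n.Partition) :
    Representation k (Equiv.Perm (Fin n)) (spechtSpace k lam) :=
  (tabloidRep k n).subrepresentation (spechtSpace k lam) fun σ => by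
    refine Submodule.span_le.2 ?_
    rintro _ ⟨T, rfl⟩
    have : tabloidRep k n σ (polytabloid k T) ∈ spechtSpace k lam := by
      rw [tabloidRep_polytabloid]
      exact Submodule.subset_span ⟨T.act σ, rfl⟩
    exact this

/-- The direct sum of `m` copies of `S^(n)`. -/
def trivials (k : Type*) [Field k] (n m : ℕ) :
    Representation k (Equiv.Perm (Fin n))
      (DirectSum (Fin m) fun _ => spechtSpace k (Nat.Partition.indiscrete n)) :=
  Representation.directSum fun _ : Fin m => specht k (Nat.Partition.indiscrete n)

end SymCI

end

/-! Write `W = I/𝔪I`. The key point is that a transposition `s = (i j)` acts on `W` trivially or as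
a reflection. In characteristic `0` each `f ∈ I` is half of `(f - sf) + (f + sf)`. The first summand
is divisible by `x_i - x_j`, and the second is `s`-invariant. So, modulo `𝔪I`, the ideal lies in the
one generated by `x_i - x_j` and by lifts of a basis of the fixed space `W^s`. Localizing at `𝔪`,
Nakayama's lemma and dimension theory bound the length `r` of the regular sequence by `1 + dim W^s`
(`length_le_of_le_sup`). Since `dim W ≤ r`, the fixed space has codimension at most `1`
(`finrank_range_sub_genRep_swap_le_one`).

The rest is the classification of such representations (`IsReflectionRep.classification`). If some
transposition `(a b)` acts nontrivially, let `α` span the line `antiSpace ρ a b`. If `α` also spans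
the line of an adjacent transposition, it spans all of the lines and transforms by the sign. If it
spans the line of a disjoint transposition, then `n = 4` and `S^(2,2)` appears. Otherwise the
standard representation appears.

In each case there is a vector fixed by the row stabilizer of a tableau whose column
antisymmetrization is nonzero. It defines an equivariant map from the Specht module
(`exists_equivariant_map`). Irreducibility of Specht modules is not needed: injectivity follows from
the absence of invariants and from transpositions acting as reflections
(`IsReflectionRep.injective_and_le_range`), and averaging supplies a trivial complement. The bounds
on `m` come from `1 ≤ dim W ≤ n` and lower bounds for the dimensions of the Specht modules. -/

namespace SymCI

open MvPolynomial

/-! ### Regular sequences, Nakayama's lemma and Krull dimension -/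

section CommAlg

variable {R : Type*} [CommRing R] [IsNoetherianRing R]

/-- If, up to `p I`, the ideal `I` generated by a regular sequence in a prime `p` is contained in
`(x) + (G)`, then the length of the regular sequence is at most `1 + |G|`. -/
theorem length_le_of_le_sup (p : Ideal R) [p.IsPrime] (rs : List R)
    (hreg : RingTheory.Sequence.IsWeaklyRegular R rs) (hp : Ideal.ofList rs ≤ p)
    (x : R) (hx : x ∈ p) (G : Finset R) (hG : (G : Set R) ⊆ p)
    (h : Ideal.ofList rs ≤ Ideal.span {x} ⊔ Ideal.span G ⊔ p * Ideal.ofList rs) :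
    rs.length ≤ G.card + 1 := by
  classical
  let A := Localization.AtPrime p
  let φ := algebraMap R A
  have hmem : ∀ r ∈ rs, r ∈ p := fun r hr => hp (Ideal.subset_span hr)
  have hregA := hreg.isRegular_of_isLocalization_of_mem A p hmem
  have hdim := ringKrullDim_add_length_eq_ringKrullDim_of_isRegular _ hregA
  rw [← Ideal.map_ofList, List.length_map] at hdim
  let S : Finset A := (insert x G).image φ
  let J : Ideal A := Ideal.span S
  have hJ : J = (Ideal.span {x} ⊔ Ideal.span G).map φ := by
    rw [← Ideal.span_union, Ideal.map_span]
    rw [Set.singleton_union, ← Finset.coe_insert, ← Finset.coe_image]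
  have hmax : p.map φ = IsLocalRing.maximalIdeal A := Localization.AtPrime.map_eq_maximalIdeal
  -- Nakayama's lemma in the local ring `A` discards the summand `p * Ideal.ofList rs`.
  have hle : (Ideal.ofList rs).map φ ≤ J := by
    refine Submodule.le_of_le_smul_of_le_jacobson_bot (I := IsLocalRing.maximalIdeal A)
      (IsNoetherian.noetherian _) (IsLocalRing.maximalIdeal_le_jacobson _) ?_
    rw [hJ, ← hmax, smul_eq_mul, ← Ideal.map_mul, ← Ideal.map_sup]
    exact Ideal.map_mono h
  have hSj : (S : Set A) ⊆ Ring.jacobson A := by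
    rw [IsLocalRing.ringJacobson_eq_maximalIdeal, ← hmax]
    intro y hy
    obtain ⟨z, hz, rfl⟩ := Finset.mem_image.1 hy
    refine Ideal.mem_map_of_mem φ ?_
    rcases Finset.mem_insert.1 hz with rfl | hz
    · exact hx
    · exact hG hz
  have h1 := ringKrullDim_le_ringKrullDim_quotient_add_card S hSj
  have h2 : ringKrullDim (A ⧸ J) ≤ ringKrullDim (A ⧸ (Ideal.ofList rs).map φ) :=
    ringKrullDim_le_of_surjective (Ideal.Quotient.factor hle) (Ideal.Quotient.factor_surjective hle)
  have hcard : S.card ≤ G.card + 1 := Finset.card_image_le.trans (Finset.card_insert_le _ _)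
  have h3 : ringKrullDim (A ⧸ (Ideal.ofList rs).map φ) + rs.length ≤
      ringKrullDim (A ⧸ (Ideal.ofList rs).map φ) + S.card := by
    rw [hdim]
    exact h1.trans (by gcongr)
  have hbot : (Ideal.ofList rs).map φ ≠ ⊤ := by
    have : (Ideal.ofList rs).map φ ≤ p.map φ := Ideal.map_mono hp
    rw [hmax] at this
    exact fun h => Ideal.IsPrime.ne_top (inferInstance : (IsLocalRing.maximalIdeal A).IsPrime)
      (top_le_iff.1 (h ▸ this))
  have : Nontrivial (A ⧸ (Ideal.ofList rs).map φ) := Ideal.Quotient.nontrivial_iff.2 hbot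
  have : IsLocalRing (A ⧸ (Ideal.ofList rs).map φ) :=
    IsLocalRing.of_surjective' (Ideal.Quotient.mk _) Ideal.Quotient.mk_surjective
  -- In `h3` the dimension can be cancelled only once it is known to be neither `⊤` nor `⊥`.
  have hfin : ringKrullDim (A ⧸ (Ideal.ofList rs).map φ) ≠ ⊤ := ringKrullDim_ne_top
  have hb : ringKrullDim (A ⧸ (Ideal.ofList rs).map φ) ≠ ⊥ := ringKrullDim_ne_bot
  obtain ⟨d, hd⟩ := WithBot.ne_bot_iff_exists.1 hb
  rw [← hd] at h3 hfin
  have hd' : d ≠ ⊤ := fun h => hfin (by rw [h]; rfl)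
  lift d to ℕ using hd'
  have : d + rs.length ≤ d + S.card := by exact_mod_cast h3
  omega

/-- The length of a regular sequence in a prime is at most the Krull dimension. -/
theorem length_le_ringKrullDim (p : Ideal R) [p.IsPrime] (rs : List R)
    (hreg : RingTheory.Sequence.IsWeaklyRegular R rs) (hp : Ideal.ofList rs ≤ p) :
    (rs.length : WithBot ℕ∞) ≤ ringKrullDim R := by
  let A := Localization.AtPrime p
  have hmem : ∀ r ∈ rs, r ∈ p := fun r hr => hp (Ideal.subset_span hr)
  have hregA := hreg.isRegular_of_isLocalization_of_mem A p hmem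
  have hdim := ringKrullDim_add_length_eq_ringKrullDim_of_isRegular _ hregA
  rw [← Ideal.map_ofList, List.length_map] at hdim
  have hbot : (Ideal.ofList rs).map (algebraMap R A) ≠ ⊤ := by
    have : (Ideal.ofList rs).map (algebraMap R A) ≤ p.map (algebraMap R A) := Ideal.map_mono hp
    rw [Localization.AtPrime.map_eq_maximalIdeal] at this
    exact fun h => Ideal.IsPrime.ne_top (inferInstance : (IsLocalRing.maximalIdeal A).IsPrime)
      (top_le_iff.1 (h ▸ this))
  have : Nontrivial (A ⧸ (Ideal.ofList rs).map (algebraMap R A)) :=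
    Ideal.Quotient.nontrivial_iff.2 hbot
  calc (rs.length : WithBot ℕ∞)
      ≤ ringKrullDim (A ⧸ (Ideal.ofList rs).map (algebraMap R A)) + rs.length :=
        le_add_of_nonneg_left ringKrullDim_nonneg_of_nontrivial
    _ = ringKrullDim A := hdim
    _ = p.height := IsLocalization.AtPrime.ringKrullDim_eq_height p A
    _ ≤ ringKrullDim R := Ideal.height_le_ringKrullDim_of_ne_top Ideal.IsPrime.ne_top'

/-- In a Noetherian domain a nonzero ideal `I` in a prime `p` is not `p I`. -/
theorem not_le_mul_of_ne_bot [IsDomain R] (p : Ideal R) [p.IsPrime] (I : Ideal R) (hI : I ≠ ⊥) :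
    ¬ I ≤ p * I := by
  intro h
  let A := Localization.AtPrime p
  have hle : I.map (algebraMap R A) ≤ ⊥ := by
    refine Submodule.le_of_le_smul_of_le_jacobson_bot (I := IsLocalRing.maximalIdeal A)
      (IsNoetherian.noetherian _) (IsLocalRing.maximalIdeal_le_jacobson _) ?_
    rw [bot_sup_eq, ← Localization.AtPrime.map_eq_maximalIdeal, smul_eq_mul, ← Ideal.map_mul]
    exact Ideal.map_mono h
  refine hI ((Submodule.eq_bot_iff _).2 fun x hx => ?_)
  have : algebraMap R A x = 0 := by simpa using hle (Ideal.mem_map_of_mem _ hx)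
  exact (IsLocalization.injective A p.primeCompl_le_nonZeroDivisors) (by simpa using this)

end CommAlg

/-! ### Transpositions and the irrelevant ideal of the polynomial ring -/

section Polynomial

variable {k : Type*} [Field k] {n : ℕ}

/-- Once `x_i` and `x_j` are identified, exchanging them changes nothing. -/
theorem rename_swap_sub_mem (i j : Fin n) (f : MvPolynomial (Fin n) k) :
    f - rename (Equiv.swap i j) f ∈ Ideal.span {(X i - X j : MvPolynomial (Fin n) k)} := by
  rw [← Ideal.Quotient.eq]
  let q := Ideal.Quotient.mkₐ k (Ideal.span {(X i - X j : MvPolynomial (Fin n) k)})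
  have hij : q (X i) = q (X j) :=
    Ideal.Quotient.eq.2 (Ideal.subset_span rfl)
  have h : q = q.comp (rename (Equiv.swap i j)) := by
    refine MvPolynomial.algHom_ext fun l => ?_
    simp only [AlgHom.comp_apply, rename_X, Equiv.swap_apply_def]
    split_ifs with h1 h2
    · rw [h1, hij]
    · rw [h2, hij]
    · rfl
  exact DFunLike.congr_fun h f

theorem mem_irrelevant_iff (f : MvPolynomial (Fin n) k) :
    f ∈ irrelevant k n ↔ constantCoeff f = 0 := by
  have := mem_pow_idealOfVars_iff' (σ := Fin n) (R := k) 1 f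
  rw [pow_one] at this
  refine Iff.trans this ⟨fun h => h 0 (by simp), fun h x hx => ?_⟩
  have : x = 0 := by simpa [Finsupp.degree_eq_zero_iff] using hx
  rw [this]; exact h

theorem irrelevant_isPrime (k : Type*) [Field k] (n : ℕ) : (irrelevant k n).IsPrime := by
  have : irrelevant k n = RingHom.ker (constantCoeff : MvPolynomial (Fin n) k →+* k) := by
    ext f; rw [mem_irrelevant_iff, RingHom.mem_ker]
  rw [this]
  exact RingHom.ker_isPrime _

/-- A nonzero constant term would itself lie in the homogeneous ideal `I`, which would then contain
a unit. -/
theorem IsHomogeneousIdeal.le_irrelevant {I : Ideal (MvPolynomial (Fin n) k)}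
    (h : IsHomogeneousIdeal I) (hI : I ≠ ⊤) : I ≤ irrelevant k n := by
  intro f hf
  rw [mem_irrelevant_iff]
  by_contra hc
  let _ : GradedAlgebra (homogeneousSubmodule (Fin n) k) := gradedAlgebra
  have h0 := h 0 hf
  have h1 : ((DirectSum.decompose (homogeneousSubmodule (Fin n) k) f 0 :
      homogeneousSubmodule (Fin n) k 0) : MvPolynomial (Fin n) k) = C (constantCoeff f) := by
    have := MvPolynomial.decomposition.decompose'_apply f 0
    rw [show C (constantCoeff f) = homogeneousComponent 0 f from (homogeneousComponent_zero f).symm]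
    exact this
  rw [h1] at h0
  exact hI (Ideal.eq_top_of_isUnit_mem _ h0 ((isUnit_iff_ne_zero.2 hc).map C))

end Polynomial

/-! ### Transpositions on the space of minimal generators -/

section GenRep

variable {k : Type*} [Field k] {n : ℕ} {I : Ideal (MvPolynomial (Fin n) k)}

theorem sub_C_mul_mem (a x : MvPolynomial (Fin n) k) (hx : x ∈ I) :
    a * x - constantCoeff a • x ∈ irrelevant k n * I := by
  rw [smul_eq_C_mul, ← sub_mul]
  exact Ideal.mul_mem_mul ((mem_irrelevant_iff _).2 (by simp)) hx

theorem getElem_mem_of_ofList_eq {R : Type*} [CommRing R] {I : Ideal R} {rs : List R}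
    (hrs : Ideal.ofList rs = I) (i : Fin rs.length) : rs[i] ∈ I := by
  rw [← hrs]
  exact Ideal.subset_span (List.getElem_mem i.2)

/-- Modulo `𝔪I` a polynomial coefficient acts through its constant term, so generators of the ideal
span the quotient over `k`. -/
theorem span_range_mk_eq_top (rs : List (MvPolynomial (Fin n) k)) (hrs : Ideal.ofList rs = I) :
    Submodule.span k (Set.range fun i : Fin rs.length => (irrelevantMul I).mkQ
      ⟨rs[i], getElem_mem_of_ofList_eq hrs i⟩) = ⊤ := by
  set N := Submodule.span k (Set.range fun i : Fin rs.length => (irrelevantMul I).mkQ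
      ⟨rs[i], getElem_mem_of_ofList_eq hrs i⟩)
  have key : ∀ f ∈ Ideal.span {r | r ∈ rs}, ∀ h : f ∈ I,
      (irrelevantMul I).mkQ ⟨f, h⟩ ∈ N := by
    intro f hf
    refine Submodule.span_induction (p := fun f _ => ∀ h : f ∈ I,
      (irrelevantMul I).mkQ ⟨f, h⟩ ∈ N) ?_ ?_ ?_ ?_ hf
    · intro x hx h
      obtain ⟨i, hi, rfl⟩ := List.mem_iff_getElem.1 hx
      exact Submodule.subset_span ⟨⟨i, hi⟩, rfl⟩
    · intro h
      have : (⟨0, h⟩ : I.restrictScalars k) = 0 := rfl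
      rw [this, map_zero]
      exact N.zero_mem
    · intro x y hx hy ihx ihy h
      have hx' : x ∈ I := hrs ▸ hx
      have hy' : y ∈ I := hrs ▸ hy
      have : (⟨x + y, h⟩ : I.restrictScalars k) = ⟨x, hx'⟩ + ⟨y, hy'⟩ := rfl
      rw [this, map_add]
      exact N.add_mem (ihx hx') (ihy hy')
    · intro a x hx ih h
      have hx' : x ∈ I := hrs ▸ hx
      have : (irrelevantMul I).mkQ ⟨a • x, h⟩ =
          constantCoeff a • (irrelevantMul I).mkQ ⟨x, hx'⟩ := by
        rw [← map_smul]
        exact (Submodule.Quotient.eq _).2 (sub_C_mul_mem a x hx')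
      rw [this]
      exact N.smul_mem _ (ih hx')
  refine eq_top_iff.2 fun w _ => ?_
  obtain ⟨f, rfl⟩ := (irrelevantMul I).mkQ_surjective w
  exact key f.1 (show f.1 ∈ Ideal.ofList rs from hrs ▸ f.2) f.2

theorem finite_quotient_irrelevantMul (hci : IsCompleteIntersection I) :
    Module.Finite k (I.restrictScalars k ⧸ irrelevantMul I) := by
  obtain ⟨rs, -, hrs⟩ := hci
  exact ⟨(Submodule.fg_def).2 ⟨_, Set.finite_range _, span_range_mk_eq_top rs hrs⟩⟩

theorem finrank_quotient_irrelevantMul_le_length (rs : List (MvPolynomial (Fin n) k))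
    (hrs : Ideal.ofList rs = I) :
    Module.finrank k (I.restrictScalars k ⧸ irrelevantMul I) ≤ rs.length := by
  have := finrank_range_le_card (R := k) (fun i : Fin rs.length => (irrelevantMul I).mkQ
      ⟨rs[i], getElem_mem_of_ofList_eq hrs i⟩)
  rwa [Set.finrank, span_range_mk_eq_top rs hrs, finrank_top, Fintype.card_fin] at this

theorem IsCompleteIntersection.ne_top {R : Type*} [CommRing R] {I : Ideal R}
    (hci : IsCompleteIntersection I) : I ≠ ⊤ := by
  obtain ⟨rs, hreg, rfl⟩ := hci
  intro h
  exact hreg.top_ne_smul (by simp [h])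

theorem finrank_quotient_irrelevantMul_le (hhom : IsHomogeneousIdeal I)
    (hci : IsCompleteIntersection I) :
    Module.finrank k (I.restrictScalars k ⧸ irrelevantMul I) ≤ n := by
  have hle := hhom.le_irrelevant hci.ne_top
  obtain ⟨rs, hreg, hrs⟩ := hci
  have := irrelevant_isPrime k n
  have h := length_le_ringKrullDim (irrelevant k n) rs hreg.toIsWeaklyRegular (hrs ▸ hle)
  rw [MvPolynomial.ringKrullDim_of_isNoetherianRing, ringKrullDim_eq_zero_of_field, zero_add,
    Nat.card_fin] at h
  exact (finrank_quotient_irrelevantMul_le_length rs hrs).trans (by exact_mod_cast h)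

theorem nontrivial_quotient_irrelevantMul (hne : I ≠ ⊥) :
    Nontrivial (I.restrictScalars k ⧸ irrelevantMul I) := by
  rw [Submodule.Quotient.nontrivial_iff]
  intro h
  have := irrelevant_isPrime k n
  refine not_le_mul_of_ne_bot (irrelevant k n) I hne fun x hx => ?_
  have : (⟨x, hx⟩ : I.restrictScalars k) ∈ irrelevantMul I := h ▸ Submodule.mem_top
  exact this

/-- On the minimal generators of an invariant homogeneous complete intersection ideal, every
transposition acts as the identity or as a reflection. -/
theorem finrank_range_sub_genRep_swap_le_one [CharZero k] (hhom : IsHomogeneousIdeal I)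
    (hst : IsStable I) (hci : IsCompleteIntersection I) (i j : Fin n) :
    Module.finrank k (LinearMap.range (1 - genRep I hst (Equiv.swap i j))) ≤ 1 := by
  classical
  have hle := hhom.le_irrelevant hci.ne_top
  have hfin := finite_quotient_irrelevantMul hci
  obtain ⟨rs, hreg, hrs⟩ := hci
  have := irrelevant_isPrime k n
  set s := genRep I hst (Equiv.swap i j) with hs
  have hsm : ∀ f : I.restrictScalars k, s ((irrelevantMul I).mkQ f) =
      (irrelevantMul I).mkQ ⟨rename (Equiv.swap i j) f.1, hst _ _ f.2⟩ := fun f => rfl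
  have hss : ∀ w, s (s w) = w := by
    intro w
    rw [hs, ← Module.End.mul_apply, ← map_mul, Equiv.swap_mul_self, map_one, Module.End.one_apply]
  -- `K` is the fixed space of `s`, and `G` below lifts a basis of it. The aim is `rs.length ≤
  -- G.card + 1 ≤ dim K + 1`.
  let K := LinearMap.ker (1 - s)
  let b := Module.finBasis k K
  choose g hg using fun l => (irrelevantMul I).mkQ_surjective (b l : _)
  let G : Finset (MvPolynomial (Fin n) k) := Finset.univ.image fun l => (g l).1
  have hcard : G.card ≤ Module.finrank k K := Finset.card_image_le.trans (by simp)
  have hGI : ∀ x ∈ G, x ∈ I := by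
    intro x hx
    obtain ⟨l, -, rfl⟩ := Finset.mem_image.1 hx
    exact (g l).2
  have hker : ∀ f : I.restrictScalars k, (irrelevantMul I).mkQ f ∈ K →
      f.1 ∈ Ideal.span G ⊔ irrelevant k n * I := by
    intro f hf
    have h1 := congrArg (Subtype.val) (b.sum_repr ⟨_, hf⟩)
    set c := b.repr ⟨_, hf⟩
    have h2 : (irrelevantMul I).mkQ (∑ l, c l • g l) = (irrelevantMul I).mkQ f := by
      rw [map_sum]
      refine Eq.trans ?_ h1
      simp [hg]
    have h3 : f.1 - (∑ l, c l • g l : I.restrictScalars k).1 ∈ irrelevant k n * I :=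
      (Submodule.Quotient.eq (irrelevantMul I)).1 h2.symm
    have h4 : (∑ l, c l • g l : I.restrictScalars k).1 ∈ Ideal.span (G : Set _) := by
      rw [Submodule.coe_sum]
      refine Ideal.sum_mem _ fun l _ => ?_
      rw [Submodule.coe_smul, smul_eq_C_mul]
      exact Ideal.mul_mem_left _ _ (Ideal.subset_span
        (Finset.mem_coe.2 (Finset.mem_image_of_mem _ (Finset.mem_univ l))))
    have := Submodule.add_mem_sup h4 h3
    rwa [add_sub_cancel] at this
  have hx : (X i - X j : MvPolynomial (Fin n) k) ∈ irrelevant k n :=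
    Ideal.sub_mem _ (Ideal.subset_span ⟨i, rfl⟩) (Ideal.subset_span ⟨j, rfl⟩)
  have hI : I ≤ Ideal.span {X i - X j} ⊔ Ideal.span G ⊔ irrelevant k n * I := by
    intro f hf
    have h1 : f + rename (Equiv.swap i j) f ∈ Ideal.span G ⊔ irrelevant k n * I := by
      refine hker ⟨f + rename (Equiv.swap i j) f, I.add_mem hf (hst _ _ hf)⟩ ?_
      have h3 : (irrelevantMul I).mkQ ⟨f + rename (Equiv.swap i j) f, I.add_mem hf (hst _ _ hf)⟩
          = (irrelevantMul I).mkQ ⟨f, hf⟩ + s ((irrelevantMul I).mkQ ⟨f, hf⟩) := by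
        rw [hsm, ← map_add]; rfl
      rw [h3, LinearMap.mem_ker, LinearMap.sub_apply, map_add s, hss, Module.End.one_apply,
        add_comm, sub_self]
    have h2 := rename_swap_sub_mem i j f
    -- The antisymmetric part is absorbed by `X i - X j`, the symmetric part by `G` up to `𝔪I`.
    have h3 : f = C (1 / 2) * ((f - rename (Equiv.swap i j) f) + (f + rename (Equiv.swap i j) f)) := by
      rw [sub_add_add_cancel, ← two_mul, ← mul_assoc, show (2 : MvPolynomial (Fin n) k) = C 2 from
        (map_ofNat C 2).symm, ← C_mul]
      norm_num
    rw [h3, sup_assoc]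
    exact Ideal.mul_mem_left _ _ (Submodule.add_mem_sup h2 h1)
  have hlen := length_le_of_le_sup (irrelevant k n) rs hreg.toIsWeaklyRegular (hrs ▸ hle) _ hx G
    (fun x hx => hle (hGI x hx)) (by rw [hrs]; exact hI)
  have h1 := finrank_quotient_irrelevantMul_le_length rs hrs
  have h2 := LinearMap.finrank_range_add_finrank_ker (1 - s)
  change Module.finrank k _ + Module.finrank k K = _ at h2
  omega

end GenRep

/-! ### Configurations of the reflected lines -/

section Reflections

variable {k : Type*} [Field k] {n : ℕ} {V : Type*} [AddCommGroup V] [Module k V]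
  (ρ : Representation k (Equiv.Perm (Fin n)) V)

theorem rep_mul_apply (g h : Equiv.Perm (Fin n)) (v : V) : ρ (g * h) v = ρ g (ρ h v) := by
  rw [map_mul, Module.End.mul_apply]

theorem rep_swap_swap (i j : Fin n) (v : V) :
    ρ (Equiv.swap i j) (ρ (Equiv.swap i j) v) = v := by
  rw [← rep_mul_apply, Equiv.swap_mul_self, map_one, Module.End.one_apply]

/-- The image of `1 - (i j)`. -/
def antiSpace (i j : Fin n) : Submodule k V :=
  LinearMap.range (1 - ρ (Equiv.swap i j))

variable {ρ}

theorem sub_mem_antiSpace (i j : Fin n) (v : V) :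
    v - ρ (Equiv.swap i j) v ∈ antiSpace ρ i j := ⟨v, rfl⟩

theorem antiSpace_comm (i j : Fin n) : antiSpace ρ i j = antiSpace ρ j i := by
  rw [antiSpace, Equiv.swap_comm, antiSpace]

theorem swap_apply_of_mem_antiSpace {i j : Fin n} {v : V} (hv : v ∈ antiSpace ρ i j) :
    ρ (Equiv.swap i j) v = -v := by
  obtain ⟨w, rfl⟩ := hv
  simp [rep_swap_swap]

theorem mem_antiSpace_of_swap_apply [CharZero k] {i j : Fin n} {v : V}
    (hv : ρ (Equiv.swap i j) v = -v) : v ∈ antiSpace ρ i j := by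
  refine ⟨(2⁻¹ : k) • v, ?_⟩
  rw [LinearMap.sub_apply, map_smul (ρ _), hv, Module.End.one_apply, smul_neg, sub_neg_eq_add,
    ← add_smul]
  norm_num

theorem apply_mem_antiSpace {i j : Fin n} {v : V} (hv : v ∈ antiSpace ρ i j)
    (g : Equiv.Perm (Fin n)) : ρ g v ∈ antiSpace ρ (g i) (g j) := by
  obtain ⟨w, rfl⟩ := hv
  refine ⟨ρ g w, ?_⟩
  simp only [LinearMap.sub_apply, Module.End.one_apply, map_sub]
  rw [← rep_mul_apply, ← rep_mul_apply, Equiv.mul_swap_eq_swap_mul]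

theorem exists_perm_apply_eq {a b i j : Fin n} (hab : a ≠ b) (hij : i ≠ j) :
    ∃ g : Equiv.Perm (Fin n), g a = i ∧ g b = j := by
  refine ⟨Equiv.swap (Equiv.swap a i b) j * Equiv.swap a i, ?_, ?_⟩
  · have : i ≠ Equiv.swap a i b := by
      intro h
      apply hab
      have := congrArg (Equiv.swap a i) h
      simpa using this
    simp [Equiv.swap_apply_of_ne_of_ne this hij]
  · simp

theorem mem_invariants_of_swap {v : V} (hv : ∀ i j, i ≠ j → ρ (Equiv.swap i j) v = v) :
    v ∈ ρ.invariants := by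
  intro g
  induction g using Equiv.Perm.swap_induction_on with
  | one => simp
  | swap_mul f x y hxy ih => rw [rep_mul_apply, ih, hv x y hxy]

/-- `ρ` is a reflection representation if each transposition acts as a reflection or trivially. -/
def IsReflectionRep (ρ : Representation k (Equiv.Perm (Fin n)) V) : Prop :=
  ∀ i j, Module.finrank k (antiSpace ρ i j) ≤ 1

section

variable [FiniteDimensional k V] (hρ : IsReflectionRep ρ)
include hρ

theorem IsReflectionRep.exists_smul {i j : Fin n} {α v : V} (hα : α ∈ antiSpace ρ i j)
    (hα0 : α ≠ 0) (hv : v ∈ antiSpace ρ i j) : ∃ c : k, v = c • α := by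
  obtain ⟨w, hw⟩ := finrank_le_one_iff.1 (hρ i j)
  obtain ⟨c, hc⟩ := hw ⟨α, hα⟩
  obtain ⟨d, hd⟩ := hw ⟨v, hv⟩
  have hc' : c • w.1 = α := congrArg Subtype.val hc
  have hd' : d • w.1 = v := congrArg Subtype.val hd
  have hc0 : c ≠ 0 := by
    rintro rfl
    exact hα0 (by rw [← hc', zero_smul])
  exact ⟨d * c⁻¹, by rw [← hd', ← hc', smul_smul, mul_assoc, inv_mul_cancel₀ hc0, mul_one]⟩

theorem IsReflectionRep.mem_of_mem {i j x y : Fin n} {α v : V} (hα : α ∈ antiSpace ρ i j)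
    (hv : v ∈ antiSpace ρ i j) (hv0 : v ≠ 0) (hv' : v ∈ antiSpace ρ x y) :
    α ∈ antiSpace ρ x y := by
  obtain ⟨c, rfl⟩ := hρ.exists_smul hv hv0 hα
  exact Submodule.smul_mem _ c hv'

end

theorem rep_apply_ne_zero (g : Equiv.Perm (Fin n)) {v : V} (hv : v ≠ 0) : ρ g v ≠ 0 := by
  intro h
  apply hv
  have := congrArg (ρ g⁻¹) h
  rwa [← rep_mul_apply, inv_mul_cancel, map_one, Module.End.one_apply, map_zero] at this

/-- The braid relation for two distinct adjacent reflections. -/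
theorem IsReflectionRep.swap_swap_apply [FiniteDimensional k V] (hρ : IsReflectionRep ρ)
    {a b c : Fin n} (hab : a ≠ b) (hca : c ≠ a) (hcb : c ≠ b) {α : V}
    (hα : α ∈ antiSpace ρ a b) (hα' : α ∉ antiSpace ρ b c) :
    ρ (Equiv.swap a b) (ρ (Equiv.swap b c) α) = ρ (Equiv.swap b c) α - α := by
  have h0 : α ≠ 0 := fun h => hα' (h ▸ Submodule.zero_mem _)
  obtain ⟨d, hd⟩ := hρ.exists_smul hα h0 (sub_mem_antiSpace a b (ρ (Equiv.swap b c) α))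
  -- Conjugation carries the line of `(a b)` to that of `(a c)` and then to that of `(b c)`.
  have h1 : ρ (Equiv.swap a b) (ρ (Equiv.swap b c) α) ∈ antiSpace ρ b c := by
    have := apply_mem_antiSpace (apply_mem_antiSpace hα (Equiv.swap b c)) (Equiv.swap a b)
    rwa [Equiv.swap_apply_of_ne_of_ne hab hca.symm, Equiv.swap_apply_left b c,
      Equiv.swap_apply_left, Equiv.swap_apply_of_ne_of_ne hca hcb] at this
  have h2 : (1 - d) • α ∈ antiSpace ρ b c := by
    have := Submodule.add_mem _ (sub_mem_antiSpace b c α) h1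
    convert this using 1
    rw [sub_smul, one_smul, ← hd]
    abel
  -- Otherwise `h2` could be divided by `1 - d`, placing `α` on the line of `(b c)`.
  have h3 : d = 1 := by
    by_contra h
    refine hα' ?_
    have := Submodule.smul_mem _ (1 - d)⁻¹ h2
    rwa [smul_smul, inv_mul_cancel₀ (sub_ne_zero.2 (Ne.symm h)), one_smul] at this
  rw [h3, one_smul] at hd
  rw [sub_eq_iff_eq_add] at hd
  rw [eq_sub_iff_add_eq, add_comm, ← hd]

/-- Conjugating by `(c x)` keeps the line of `(a b)` and moves that of `(b c)` to that of `(b x)`,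
so all transpositions involving `b` share one line. Conjugating by `(b i)` then reaches the
remaining ones. -/
theorem IsReflectionRep.mem_antiSpace_of_adjacent [FiniteDimensional k V]
    (hρ : IsReflectionRep ρ) {a b c : Fin n} (hca : c ≠ a) (hcb : c ≠ b) {α : V}
    (h0 : α ≠ 0) (hα : α ∈ antiSpace ρ a b) (hα' : α ∈ antiSpace ρ b c) {i j : Fin n}
    (hij : i ≠ j) : α ∈ antiSpace ρ i j := by
  have hb : ∀ x, x ≠ b → α ∈ antiSpace ρ b x := by
    intro x hxb
    by_cases hxa : x = a
    · rw [hxa, antiSpace_comm]; exact hα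
    have h1 := apply_mem_antiSpace hα (Equiv.swap c x)
    have h2 := apply_mem_antiSpace hα' (Equiv.swap c x)
    rw [Equiv.swap_apply_of_ne_of_ne hca.symm (Ne.symm hxa),
      Equiv.swap_apply_of_ne_of_ne hcb.symm hxb.symm] at h1
    rw [Equiv.swap_apply_of_ne_of_ne hcb.symm hxb.symm, Equiv.swap_apply_left] at h2
    exact hρ.mem_of_mem hα h1 (rep_apply_ne_zero _ h0) h2
  by_cases hib : i = b
  · rw [hib]; exact hb j (fun h => hij (hib.trans h.symm))
  by_cases hjb : j = b
  · rw [hjb, antiSpace_comm]; exact hb i hib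
  have h1 := apply_mem_antiSpace (hb j hjb) (Equiv.swap b i)
  rw [swap_apply_of_mem_antiSpace (hb i hib), Equiv.swap_apply_left,
    Equiv.swap_apply_of_ne_of_ne hjb hij.symm, Submodule.neg_mem_iff] at h1
  exact h1

/-- A vector spanning all the lines `antiSpace` transforms by the sign. -/
theorem apply_eq_sign_smul {α : V} (h : ∀ i j, i ≠ j → α ∈ antiSpace ρ i j)
    (g : Equiv.Perm (Fin n)) : ρ g α = ((Equiv.Perm.sign g : ℤ) : k) • α := by
  induction g using Equiv.Perm.swap_induction_on with
  | one => simp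
  | swap_mul f x y hxy ih =>
    rw [rep_mul_apply, ih, map_smul, swap_apply_of_mem_antiSpace (h x y hxy),
      Equiv.Perm.sign_mul, Equiv.Perm.sign_swap hxy]
    simp

theorem IsReflectionRep.apply_eq_self [FiniteDimensional k V] (hρ : IsReflectionRep ρ)
    {a b : Fin n} {α : V} (hα : α ∈ antiSpace ρ a b)
    (hd : ∀ c d, c ≠ a → c ≠ b → d ≠ a → d ≠ b → c ≠ d → α ∉ antiSpace ρ c d)
    (g : Equiv.Perm (Fin n)) (ha : g a = a) (hb : g b = b) : ρ g α = α := by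
  by_cases h0 : α = 0
  · rw [h0, map_zero]
  have key : ∀ f : Equiv.Perm {i : Fin n // i ≠ a ∧ i ≠ b},
      ρ (Equiv.Perm.ofSubtype f) α = α := by
    intro f
    induction f using Equiv.Perm.swap_induction_on with
    | one => simp
    | swap_mul f x y hxy ih =>
      rw [map_mul, rep_mul_apply, ih, Equiv.Perm.ofSubtype_swap_eq]
      have h1 := apply_mem_antiSpace hα (Equiv.swap (x : Fin n) y)
      rw [Equiv.swap_apply_of_ne_of_ne x.2.1.symm y.2.1.symm,
        Equiv.swap_apply_of_ne_of_ne x.2.2.symm y.2.2.symm] at h1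
      by_contra h
      -- If nonzero, `α - (x y)α` would lie on the lines of both `(a b)` and `(x y)`, so these lines
      -- would coincide, against `hd`.
      have h2 := Submodule.sub_mem _ hα h1
      exact hd x y x.2.1 x.2.2 y.2.1 y.2.2 (fun h => hxy (Subtype.ext h))
        (hρ.mem_of_mem hα h2 (sub_ne_zero.2 (Ne.symm h)) (sub_mem_antiSpace _ _ _))
  have hg : ∀ i, i ≠ a ∧ i ≠ b ↔ g i ≠ a ∧ g i ≠ b := by
    intro i
    rw [← g.injective.ne_iff (x := i) (y := a), ← g.injective.ne_iff (x := i) (y := b), ha, hb]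
  have := key (g.subtypePerm fun i => (hg i).symm)
  rwa [Equiv.Perm.ofSubtype_subtypePerm] at this
  intro i hi
  constructor
  · rintro rfl; exact hi ha
  · rintro rfl; exact hi hb

/-- If the lines of `(a b)` and of the transpositions disjoint from or adjacent to it are distinct,
then there is a vector fixed by the stabilizer of `a` and not by `(a b)`. -/
theorem IsReflectionRep.exists_standard [CharZero k] [FiniteDimensional k V]
    (hρ : IsReflectionRep ρ) {a b : Fin n} (hab : a ≠ b) {α : V} (h0 : α ≠ 0)
    (hα : α ∈ antiSpace ρ a b)
    (hadj : ∀ c, c ≠ a → c ≠ b → α ∉ antiSpace ρ b c)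
    (hd : ∀ c d, c ≠ a → c ≠ b → d ≠ a → d ≠ b → c ≠ d → α ∉ antiSpace ρ c d) :
    ∃ u : V, (∀ g : Equiv.Perm (Fin n), g a = a → ρ g u = u) ∧ u - ρ (Equiv.swap a b) u ≠ 0 := by
  classical
  -- In the model `α = e_b - e_a`, the summands are `e_j - e_a`, and their sum is visibly fixed by
  -- the stabilizer of `a`. Applying `1 - (a b)` gives `2α` from `j = b` and `α` from each of the
  -- other `n - 2` indices, hence `nα`.
  refine ⟨∑ j ∈ Finset.univ.erase a, ρ (Equiv.swap b j) α, ?_, ?_⟩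
  · intro g hg
    rw [map_sum]
    refine Finset.sum_equiv g ?_ ?_
    · intro i
      have := g.injective.eq_iff (a := i) (b := a)
      rw [hg] at this
      simp [this]
    · intro j hj
      have hja := Finset.ne_of_mem_erase hj
      have hgj : g j ≠ a := by rw [← hg]; exact g.injective.ne hja
      have := hρ.apply_eq_self hα hd (Equiv.swap b (g j) * g * Equiv.swap b j) (by
        rw [Equiv.Perm.mul_apply, Equiv.Perm.mul_apply, Equiv.swap_apply_of_ne_of_ne hab hja.symm, hg,
          Equiv.swap_apply_of_ne_of_ne hab hgj.symm]) (by simp)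
      rw [rep_mul_apply, rep_mul_apply] at this
      nth_rw 2 [← this]
      rw [rep_swap_swap]
  · have : ∀ j ∈ Finset.univ.erase a, ρ (Equiv.swap b j) α -
        ρ (Equiv.swap a b) (ρ (Equiv.swap b j) α) = α + if b = j then α else 0 := by
      intro j hj
      split_ifs with hjb
      · rw [← hjb, Equiv.swap_self, ← Equiv.Perm.one_def, map_one, Module.End.one_apply,
          swap_apply_of_mem_antiSpace hα, sub_neg_eq_add]
      · rw [hρ.swap_swap_apply hab (Finset.ne_of_mem_erase hj) (Ne.symm hjb) hα
          (hadj j (Finset.ne_of_mem_erase hj) (Ne.symm hjb))]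
        abel
    rw [map_sum, ← Finset.sum_sub_distrib, Finset.sum_congr rfl this, Finset.sum_add_distrib,
      Finset.sum_ite_eq, if_pos (by simp [hab.symm]), Finset.sum_const,
      Finset.card_erase_of_mem (Finset.mem_univ a), Finset.card_univ, Fintype.card_fin,
      ← succ_nsmul, Nat.sub_add_cancel (Nat.one_le_of_lt a.2), ← Nat.cast_smul_eq_nsmul k]
    exact smul_ne_zero (Nat.cast_ne_zero.2 (Nat.ne_of_gt (Nat.zero_lt_of_lt a.2))) h0

/-- With a fifth index `e`, conjugation by `(d e)` keeps the line of `(a b)` and shows that `(c d)`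
and `(c e)` share a line. These are adjacent, and moving them so that `(c d)` becomes `(a b)`
contradicts `hadj`. -/
theorem IsReflectionRep.eq_four [FiniteDimensional k V]
    (hρ : IsReflectionRep ρ) {a b c d : Fin n} (hab : a ≠ b) {α : V} (h0 : α ≠ 0)
    (hα : α ∈ antiSpace ρ a b)
    (hadj : ∀ c, c ≠ a → c ≠ b → α ∉ antiSpace ρ b c)
    (hca : c ≠ a) (hcb : c ≠ b) (hda : d ≠ a) (hdb : d ≠ b) (hcd : c ≠ d)
    (hα' : α ∈ antiSpace ρ c d) : n = 4 ∧ ∀ e, e = a ∨ e = b ∨ e = c ∨ e = d := by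
  have hall : ∀ e, e = a ∨ e = b ∨ e = c ∨ e = d := by
    intro e
    by_contra! h
    obtain ⟨hea, heb, hec, hed⟩ := h
    have h1 := apply_mem_antiSpace hα (Equiv.swap d e)
    have h2 := apply_mem_antiSpace hα' (Equiv.swap d e)
    rw [Equiv.swap_apply_of_ne_of_ne hda.symm hea.symm,
      Equiv.swap_apply_of_ne_of_ne hdb.symm heb.symm] at h1
    rw [Equiv.swap_apply_of_ne_of_ne hcd hec.symm, Equiv.swap_apply_left] at h2
    have h3 := hρ.mem_of_mem hα h1 (rep_apply_ne_zero _ h0) h2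
    obtain ⟨g, hgd, hgc⟩ := exists_perm_apply_eq hcd.symm hab
    have h4 := apply_mem_antiSpace hα' g
    have h5 := apply_mem_antiSpace h3 g
    rw [antiSpace_comm, hgd, hgc] at h4
    rw [hgc] at h5
    refine hadj (g e) ?_ ?_ (hρ.mem_of_mem hα h4 (rep_apply_ne_zero _ h0) h5)
    · rw [← hgd]; exact g.injective.ne hed
    · rw [← hgc]; exact g.injective.ne hec
  refine ⟨?_, hall⟩
  have h1 : (Finset.univ : Finset (Fin n)) = {a, b, c, d} := by
    ext e; simpa using hall e
  have h2 := congrArg Finset.card h1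
  rw [Finset.card_univ, Fintype.card_fin] at h2
  rw [h2]
  have h3 : b ∉ ({c, d} : Finset (Fin n)) := by simp [hcb.symm, hdb.symm]
  have h4 : a ∉ ({b, c, d} : Finset (Fin n)) := by simp [hab, hca.symm, hda.symm]
  rw [Finset.card_insert_of_notMem h4, Finset.card_insert_of_notMem h3, Finset.card_pair hcd]

theorem IsReflectionRep.exists_two_two [CharZero k] [FiniteDimensional k V]
    (hρ : IsReflectionRep ρ) {a b c d : Fin n} (hab : a ≠ b) {α : V} (h0 : α ≠ 0)
    (hα : α ∈ antiSpace ρ a b)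
    (hadj : ∀ c, c ≠ a → c ≠ b → α ∉ antiSpace ρ b c)
    (hca : c ≠ a) (hcb : c ≠ b) (hda : d ≠ a) (hdb : d ≠ b) (hcd : c ≠ d)
    (hα' : α ∈ antiSpace ρ c d) :
    ∃ u : V, ρ (Equiv.swap a c) u = u ∧ ρ (Equiv.swap b d) u = u ∧
      u - ρ (Equiv.swap a b) u - ρ (Equiv.swap c d) u +
        ρ (Equiv.swap a b) (ρ (Equiv.swap c d) u) ≠ 0 := by
  have hac : α ∉ antiSpace ρ a c := by
    intro h
    have := apply_mem_antiSpace h (Equiv.swap a b)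
    rw [swap_apply_of_mem_antiSpace hα, Equiv.swap_apply_left, Equiv.swap_apply_of_ne_of_ne hca hcb,
      Submodule.neg_mem_iff] at this
    exact hadj c hca hcb this
  have e1 : ρ (Equiv.swap a b) (ρ (Equiv.swap a c) α) = ρ (Equiv.swap a c) α - α := by
    have := hρ.swap_swap_apply hab.symm hcb hca (antiSpace_comm (ρ := ρ) a b ▸ hα) hac
    rwa [Equiv.swap_comm b a] at this
  have e2 := hρ.swap_swap_apply hab hda hdb hα (hadj d hda hdb)
  have e3 : ρ (Equiv.swap c d) (ρ (Equiv.swap a c) α) = ρ (Equiv.swap a c) α - α := by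
    have := hρ.swap_swap_apply hcd.symm hda.symm hca.symm (antiSpace_comm (ρ := ρ) c d ▸ hα')
      (antiSpace_comm (ρ := ρ) a c ▸ hac)
    rwa [Equiv.swap_comm d c, Equiv.swap_comm c a] at this
  -- Both vectors lie on the line of `(b c)`; comparing the braid relations `e1` and `e2` forces the
  -- ratio to be `1`.
  have e4 : ρ (Equiv.swap b d) α = ρ (Equiv.swap a c) α := by
    have m1 := apply_mem_antiSpace hα (Equiv.swap a c)
    rw [Equiv.swap_apply_left, Equiv.swap_apply_of_ne_of_ne hab.symm hcb.symm] at m1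
    have m2 := apply_mem_antiSpace hα' (Equiv.swap b d)
    rw [Equiv.swap_apply_right, Equiv.swap_apply_of_ne_of_ne hcb hcd] at m2
    obtain ⟨x, hx⟩ := hρ.exists_smul m1 (rep_apply_ne_zero _ h0) m2
    rw [hx, map_smul, e1, smul_sub, sub_right_inj] at e2
    have : (x - 1) • α = 0 := by rw [sub_smul, e2, one_smul, sub_self]
    have hx1 : x = 1 := by
      rcases smul_eq_zero.1 this with h | h
      · exact sub_eq_zero.1 h
      · exact absurd h h0
    rw [hx, hx1, one_smul]
  have s1 := swap_apply_of_mem_antiSpace hα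
  have s2 := swap_apply_of_mem_antiSpace hα'
  -- Symmetrizing `α` under `(a c)` also symmetrizes it under `(b d)`, by `e4`. The column
  -- antisymmetrizer `(1 - (a b))(1 - (c d))` then returns `6α`.
  refine ⟨α + ρ (Equiv.swap a c) α, ?_, ?_, ?_⟩
  · rw [map_add, rep_swap_swap, add_comm]
  · rw [map_add, e4, ← e4, rep_swap_swap, add_comm]
  · have : α + ρ (Equiv.swap a c) α - ρ (Equiv.swap a b) (α + ρ (Equiv.swap a c) α) -
        ρ (Equiv.swap c d) (α + ρ (Equiv.swap a c) α) +
        ρ (Equiv.swap a b) (ρ (Equiv.swap c d) (α + ρ (Equiv.swap a c) α)) = (6 : k) • α := by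
      simp only [map_add, map_sub, map_neg, e1, e3, s1, s2]
      module
    rw [this]
    exact smul_ne_zero (by norm_num) h0

end Reflections

/-! ### Splitting off a summand with trivial complement -/

section Decomposition

variable {k : Type*} [Field k] [CharZero k] {n : ℕ} {V S : Type*} [AddCommGroup V] [Module k V]
  [AddCommGroup S] [Module k S]
  {ρ : Representation k (Equiv.Perm (Fin n)) V} {σ : Representation k (Equiv.Perm (Fin n)) S}

omit [CharZero k] in
theorem sum_apply_mem_invariants (v : V) : ∑ g, ρ g v ∈ ρ.invariants := by
  intro h
  rw [map_sum]
  refine Fintype.sum_equiv (Equiv.mulLeft h) _ _ fun g => ?_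
  rw [Equiv.coe_mulLeft, rep_mul_apply]

/-- Writing `g` as a product of transpositions telescopes `v - gv` into elements of `N`. Hence `v`
agrees modulo `N` with its average over the group. -/
theorem exists_invariant_add_mem {N : Submodule k V}
    (hN : ∀ i j, i ≠ j → antiSpace ρ i j ≤ N) (v : V) :
    ∃ w ∈ ρ.invariants, v - w ∈ N := by
  have h1 : ∀ g, v - ρ g v ∈ N := by
    intro g
    induction g using Equiv.Perm.swap_induction_on with
    | one => simp
    | swap_mul f x y hxy ih =>
      have := N.add_mem ih (hN x y hxy (sub_mem_antiSpace x y (ρ f v)))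
      rwa [sub_add_sub_cancel, ← rep_mul_apply] at this
  have hc : (Fintype.card (Equiv.Perm (Fin n)) : k) ≠ 0 := Nat.cast_ne_zero.2 Fintype.card_ne_zero
  refine ⟨(Fintype.card (Equiv.Perm (Fin n)) : k)⁻¹ • ∑ g, ρ g v,
    Submodule.smul_mem _ _ (sum_apply_mem_invariants v), ?_⟩
  have h2 : v - (Fintype.card (Equiv.Perm (Fin n)) : k)⁻¹ • ∑ g, ρ g v =
      (Fintype.card (Equiv.Perm (Fin n)) : k)⁻¹ • ∑ g, (v - ρ g v) := by
    rw [Finset.sum_sub_distrib, Finset.sum_const, Finset.card_univ, smul_sub,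
      ← Nat.cast_smul_eq_nsmul k, smul_smul, inv_mul_cancel₀ hc, one_smul]
  rw [h2]
  exact N.smul_mem _ (N.sum_mem fun g _ => h1 g)

theorem exists_linearEquiv_prod_of_injective
    (F : S →ₗ[k] V) (hF : ∀ g x, F (σ g x) = ρ g (F x)) (hinj : Function.Injective F)
    (hS : σ.invariants = ⊥) (hN : ∀ i j, i ≠ j → antiSpace ρ i j ≤ LinearMap.range F) :
    ∃ e : (S × ρ.invariants) ≃ₗ[k] V, ∀ g x u, e (σ g x, u) = ρ g (e (x, u)) := by
  let Φ : S × ρ.invariants →ₗ[k] V := F.coprod ρ.invariants.subtype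
  have hΦ : ∀ x u, Φ (x, u) = F x + (u : V) := fun x u => rfl
  have hbij : Function.Bijective Φ := by
    constructor
    · rw [← LinearMap.ker_eq_bot, LinearMap.ker_eq_bot']
      rintro ⟨x, u⟩ h
      rw [hΦ] at h
      have hx : x ∈ σ.invariants := by
        intro g
        apply hinj
        rw [hF, eq_neg_of_add_eq_zero_left h, map_neg, u.2 g]
      rw [hS, Submodule.mem_bot] at hx
      subst hx
      rw [map_zero, zero_add] at h
      rw [show u = 0 from Subtype.ext h]
      rfl
    · intro v
      obtain ⟨w, hw, x, hx⟩ := exists_invariant_add_mem hN v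
      refine ⟨(x, ⟨w, hw⟩), ?_⟩
      rw [hΦ, hx, sub_add_cancel]
  refine ⟨LinearEquiv.ofBijective Φ hbij, fun g x u => ?_⟩
  change Φ (σ g x, u) = ρ g (Φ (x, u))
  rw [hΦ, hΦ, hF, map_add, u.2 g]

/-- An equivariant map from a representation `S` without invariants, on which transpositions act as
reflections, to a reflection representation is a direct summand with trivial complement, as
soon as it does not kill the reflected vector. -/
theorem IsReflectionRep.injective_and_le_range [FiniteDimensional k V] (hρ : IsReflectionRep ρ)
    (F : S →ₗ[k] V) (hF : ∀ g x, F (σ g x) = ρ g (F x)) (hS : σ.invariants = ⊥)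
    {a b : Fin n} (hab : a ≠ b) {β : S} (hβ : σ (Equiv.swap a b) β = -β) (hFβ : F β ≠ 0)
    (hline : ∀ x, ∃ c : k, x - σ (Equiv.swap a b) x = c • β) :
    Function.Injective F ∧ ∀ i j, i ≠ j → antiSpace ρ i j ≤ LinearMap.range F := by
  constructor
  · rw [← LinearMap.ker_eq_bot, LinearMap.ker_eq_bot']
    intro x hx
    -- On the kernel, `x - (i j)x` is a multiple of a translate of `β`; since `F` does not kill `β`,
    -- the multiple is zero.
    have : x ∈ σ.invariants := by
      refine mem_invariants_of_swap fun i j hij => ?_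
      obtain ⟨g, rfl, rfl⟩ := exists_perm_apply_eq hab hij
      obtain ⟨c, hc⟩ := hline (σ g⁻¹ x)
      have h1 : F (σ g⁻¹ x) = 0 := by rw [hF, hx, map_zero]
      have h2 := congrArg F hc
      rw [map_sub, hF (Equiv.swap a b), h1, map_zero, sub_zero, map_smul] at h2
      have hc0 : c = 0 := (smul_eq_zero.1 h2.symm).resolve_right hFβ
      rw [hc0, zero_smul, sub_eq_zero] at hc
      have h3 := congrArg (σ g) hc
      rw [← rep_mul_apply, mul_inv_cancel, map_one, Module.End.one_apply, ← rep_mul_apply,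
        ← rep_mul_apply, Equiv.mul_swap_eq_swap_mul, mul_assoc, mul_inv_cancel, mul_one] at h3
      exact h3.symm
    rwa [hS] at this
  · intro i j hij v hv
    obtain ⟨g, rfl, rfl⟩ := exists_perm_apply_eq hab hij
    have h1 : ρ g⁻¹ v ∈ antiSpace ρ a b := by
      have := apply_mem_antiSpace hv g⁻¹
      simpa using this
    have h2 : F β ∈ antiSpace ρ a b :=
      mem_antiSpace_of_swap_apply (by rw [← hF, hβ, map_neg])
    obtain ⟨c, hc⟩ := hρ.exists_smul h2 hFβ h1
    refine ⟨σ g (c • β), ?_⟩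
    rw [hF, map_smul, ← hc, ← rep_mul_apply, mul_inv_cancel, map_one, Module.End.one_apply]

end Decomposition

/-! ### Diagrams and tableaux -/

section Tableaux

theorem card_cellsOfRowLens (l : List ℕ) : (YoungDiagram.cellsOfRowLens l).card = l.sum := by
  induction l with
  | nil => rfl
  | cons a l ih =>
    rw [YoungDiagram.cellsOfRowLens, Finset.card_union_of_disjoint, Finset.card_map, ih]
    · simp
    · rw [Finset.disjoint_left]
      rintro ⟨i, j⟩ h1 h2
      simp only [Finset.mem_product, Finset.mem_singleton, Finset.mem_map] at h1 h2
      obtain ⟨⟨x, y⟩, -, h⟩ := h2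
      have := congrArg Prod.fst h
      simp [h1.1] at this

variable {n : ℕ} {lam : n.Partition}

theorem nonempty_tableau (lam : n.Partition) : Nonempty (Tableau lam) := by
  refine ⟨(Fintype.equivFinOfCardEq ?_).symm⟩
  rw [Fintype.card_coe]
  change (YoungDiagram.cellsOfRowLens (lam.parts.sort (· ≥ ·))).card = n
  rw [card_cellsOfRowLens, ← Multiset.sum_coe, Multiset.sort_eq, lam.parts_sum]

theorem mem_diagram_iff {l : List ℕ} (hl : l.Pairwise (· ≥ ·)) (h : lam.parts = l) {c : ℕ × ℕ} :
    c ∈ diagram lam ↔ ∃ h : c.1 < l.length, c.2 < l[c.1] := by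
  have hs : lam.parts.sort (· ≥ ·) = l :=
    List.Perm.eq_of_pairwise' (lam.parts.pairwise_sort (· ≥ ·)) hl
      (Multiset.coe_eq_coe.1 (by rw [Multiset.sort_eq, h]))
  rw [diagram, YoungDiagram.mem_ofRowLens]
  simp only [hs]

theorem Tableau.mem (T : Tableau lam) (i : Fin n) : (T.row i, T.col i) ∈ diagram lam := (T i).2

theorem Tableau.ext_row_col (T : Tableau lam) {i j : Fin n} (hr : T.row i = T.row j)
    (hc : T.col i = T.col j) : i = j :=
  T.injective (Subtype.ext (Prod.ext hr hc))

theorem Tableau.exists_entry (T : Tableau lam) {r c : ℕ} (h : (r, c) ∈ diagram lam) :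
    ∃ i, T.row i = r ∧ T.col i = c := by
  refine ⟨T.symm ⟨(r, c), h⟩, ?_, ?_⟩
  · rw [Tableau.row, Equiv.apply_symm_apply]
  · rw [Tableau.col, Equiv.apply_symm_apply]

theorem Tableau.exists_act_eq (T T' : Tableau lam) : ∃ σ, T.act σ = T' :=
  ⟨T.trans T'.symm, by ext1 i; simp [Tableau.act]⟩

theorem Tableau.stabilizesColumns_swap (T : Tableau lam) {i j : Fin n} (h : T.col i = T.col j) :
    T.StabilizesColumns (Equiv.swap i j) := by
  intro l
  rw [Equiv.swap_apply_def]
  split_ifs with h1 h2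
  · rw [h1, h]
  · rw [h2, h]
  · rfl

end Tableaux

/-! ### Polytabloids and maps out of Specht modules -/

section Specht

variable {k : Type*} [Field k] {n : ℕ} {lam : n.Partition}

theorem tabloidRep_single (g : Equiv.Perm (Fin n)) (r : Fin n → ℕ) (c : k) :
    tabloidRep k n g (Finsupp.single r c) = Finsupp.single (r ∘ ⇑g⁻¹) c :=
  Finsupp.mapDomain_single

theorem tabloidRep_polytabloid_of_stabilizesColumns (T : Tableau lam) {τ : Equiv.Perm (Fin n)}
    (hτ : T.StabilizesColumns τ) :
    tabloidRep k n τ (polytabloid k T) = ((Equiv.Perm.sign τ : ℤ) : k) • polytabloid k T := by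
  unfold polytabloid
  rw [map_sum, Finset.smul_sum]
  refine Finset.sum_equiv (Equiv.mulLeft τ) (fun π => ?_) fun π _ => ?_
  · simp only [Finset.mem_filter, Finset.mem_univ, true_and, Equiv.coe_mulLeft]
    exact forall_congr' fun i => by rw [Equiv.Perm.mul_apply, hτ]
  · rw [Equiv.coe_mulLeft, map_smul, ← rep_mul_apply, smul_smul, Equiv.Perm.sign_mul]
    congr 1
    have : ((Equiv.Perm.sign τ : ℤ) : k) * ((Equiv.Perm.sign τ : ℤ) : k) = 1 := by
      rw [← Int.cast_mul, ← Units.val_mul, Int.units_mul_self]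
      simp
    rw [Units.val_mul, Int.cast_mul, ← mul_assoc, this, one_mul]

theorem tabloidRep_swap_polytabloid (T : Tableau lam) {i j : Fin n} (hij : i ≠ j)
    (h : T.col i = T.col j) :
    tabloidRep k n (Equiv.swap i j) (polytabloid k T) = -polytabloid k T := by
  rw [tabloidRep_polytabloid_of_stabilizesColumns T (T.stabilizesColumns_swap h),
    Equiv.Perm.sign_swap hij]
  simp

theorem polytabloid_mem (T : Tableau lam) : polytabloid k T ∈ spechtSpace k lam :=
  Submodule.subset_span ⟨T, rfl⟩

theorem finiteDimensional_spechtSpace : FiniteDimensional k (spechtSpace k lam) := by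
  have : Finite (Tableau lam) := inferInstance
  exact FiniteDimensional.span_of_finite k (Set.finite_range _)

theorem free_spechtSpace : Module.Free k (spechtSpace k lam) :=
  Module.Free.of_divisionRing k (spechtSpace k lam)

theorem polytabloid_apply_row (T : Tableau lam) : polytabloid k T T.row = 1 := by
  rw [polytabloid, Finsupp.finsetSum_apply, Finset.sum_eq_single 1]
  · simp
  · intro π hπ h1
    rw [tabloidRep_single, Finsupp.smul_apply, Finsupp.single_apply, if_neg, smul_zero]
    intro h
    -- A permutation preserving both the rows and the columns of `T` is the identity.
    refine h1 (Equiv.ext fun i => T.ext_row_col ?_ ((Finset.mem_filter.1 hπ).2 i))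
    simpa using (congrFun h (π i)).symm
  · exact fun h => absurd (Finset.mem_filter.2 ⟨Finset.mem_univ _, fun i => rfl⟩) h

theorem one_le_finrank_spechtSpace (k : Type*) [Field k] (lam : n.Partition) :
    1 ≤ Module.finrank k (spechtSpace k lam) := by
  have := finiteDimensional_spechtSpace (k := k) (lam := lam)
  obtain ⟨T⟩ := nonempty_tableau lam
  refine Submodule.one_le_finrank_iff.2 fun h => ?_
  have h0 : polytabloid k T = 0 := (Submodule.mem_bot k).1 (h ▸ polytabloid_mem T)
  have h1 := polytabloid_apply_row (k := k) T
  rw [h0] at h1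
  exact zero_ne_one h1

/-- Two entries in the first column give a transposition negating the polytabloid, so the sum over
the group kills the Specht module. On an invariant vector that sum is multiplication by `n!`. -/
theorem specht_invariants_eq_bot [CharZero k] (h : (1, 0) ∈ diagram lam) :
    Representation.invariants (V := spechtSpace k lam) (specht k lam) = ⊥ := by
  rw [eq_bot_iff]
  intro x hx
  have h00 : (0, 0) ∈ diagram lam := (diagram lam).up_left_mem (Nat.zero_le 1) le_rfl h
  let P : ((Fin n → ℕ) →₀ k) →ₗ[k] ((Fin n → ℕ) →₀ k) := ∑ g, tabloidRep k n g
  have hP : ∀ y, P y = ∑ g, tabloidRep k n g y := fun y => by simp [P]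
  have hPs : ∀ g y, P (tabloidRep k n g y) = P y := by
    intro g y
    rw [hP, hP]
    refine Fintype.sum_equiv (Equiv.mulRight g) _ _ fun g' => ?_
    rw [Equiv.coe_mulRight, rep_mul_apply]
  have h1 : spechtSpace k lam ≤ LinearMap.ker P := by
    refine Submodule.span_le.2 ?_
    rintro _ ⟨T, rfl⟩
    obtain ⟨i, hi, hi'⟩ := T.exists_entry h00
    obtain ⟨j, hj, hj'⟩ := T.exists_entry h
    have hij : i ≠ j := by
      rintro rfl
      omega
    have h2 := hPs (Equiv.swap i j) (polytabloid k T)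
    rw [tabloidRep_swap_polytabloid T hij (hi'.trans hj'.symm), map_neg] at h2
    exact self_eq_neg.1 h2.symm
  have h2 : P x.1 = (Fintype.card (Equiv.Perm (Fin n)) : k) • x.1 := by
    rw [hP, Finset.sum_congr rfl fun g _ => show tabloidRep k n g x.1 = x.1 from
      congrArg Subtype.val (hx g), Finset.sum_const, Finset.card_univ, Nat.cast_smul_eq_nsmul]
  rw [LinearMap.mem_ker.1 (h1 x.2)] at h2
  have h3 := (smul_eq_zero.1 h2.symm).resolve_left (Nat.cast_ne_zero.2 Fintype.card_ne_zero)
  exact Subtype.ext h3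

/-- Frobenius reciprocity for the permutation module on row assignments. -/
theorem exists_equivariant_map {V : Type*} [AddCommGroup V] [Module k V]
    (ρ : Representation k (Equiv.Perm (Fin n)) V) (r : Fin n → ℕ) (u : V)
    (hu : ∀ g : Equiv.Perm (Fin n), (∀ i, r (g i) = r i) → ρ g u = u) :
    ∃ F : ((Fin n → ℕ) →₀ k) →ₗ[k] V, (∀ g x, F (tabloidRep k n g x) = ρ g (F x)) ∧
      F (Finsupp.single r 1) = u := by
  classical
  have hu' : ∀ g h : Equiv.Perm (Fin n), r ∘ ⇑g⁻¹ = r ∘ ⇑h⁻¹ → ρ g u = ρ h u := by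
    intro g h hgh
    have := hu (h⁻¹ * g) fun i => by
      have := congrFun hgh (g i)
      simpa using this.symm
    rw [rep_mul_apply] at this
    conv_rhs => rw [← this]
    rw [← rep_mul_apply, mul_inv_cancel, map_one, Module.End.one_apply]
  -- The orbit of `r` is sent to the orbit of `u`; row assignments outside it go to the default
  -- value `0`, which is harmless because the complement is stable.
  let f : (Fin n → ℕ) → V := fun r' =>
    if h : ∃ g : Equiv.Perm (Fin n), r ∘ ⇑g⁻¹ = r' then ρ h.choose u else 0
  have hf : ∀ g : Equiv.Perm (Fin n), f (r ∘ ⇑g⁻¹) = ρ g u := by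
    intro g
    have h : ∃ g' : Equiv.Perm (Fin n), r ∘ ⇑g'⁻¹ = r ∘ ⇑g⁻¹ := ⟨g, rfl⟩
    simp only [f, dif_pos h]
    exact hu' _ _ h.choose_spec
  have hf0 : ∀ r', (¬ ∃ g : Equiv.Perm (Fin n), r ∘ ⇑g⁻¹ = r') → f r' = 0 :=
    fun r' h => dif_neg h
  refine ⟨Finsupp.linearCombination k f, fun g x => ?_, ?_⟩
  · induction x using Finsupp.induction_linear with
    | zero => simp
    | add x y hx hy => rw [map_add, map_add, hx, hy, map_add, map_add]
    | single r' c =>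
      rw [tabloidRep_single, Finsupp.linearCombination_single, Finsupp.linearCombination_single,
        map_smul]
      congr 1
      by_cases h : ∃ g : Equiv.Perm (Fin n), r ∘ ⇑g⁻¹ = r'
      · obtain ⟨g', rfl⟩ := h
        rw [hf, ← rep_mul_apply, ← hf, mul_inv_rev]
        rfl
      · rw [hf0 r' h, map_zero, hf0]
        rintro ⟨g', hg'⟩
        refine h ⟨g⁻¹ * g', ?_⟩
        rw [mul_inv_rev, inv_inv, Equiv.Perm.coe_mul, ← Function.comp_assoc, hg',
          Function.comp_assoc, ← Equiv.Perm.coe_mul, inv_mul_cancel]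
        rfl
  · rw [Finsupp.linearCombination_single, one_smul]
    simpa using hf 1

end Specht

/-! ### Sums of trivial representations -/

section Trivials

variable {k : Type*} [Field k] {n : ℕ}

theorem polytabloid_indiscrete (hn : n ≠ 0) (T : Tableau (Nat.Partition.indiscrete n)) :
    polytabloid k T = Finsupp.single 0 1 := by
  have hrow : ∀ i, T.row i = 0 := by
    intro i
    have := (mem_diagram_iff (l := [n]) (by simp)
      (by rw [Nat.Partition.indiscrete_parts hn]; rfl)).1 (T.mem i)
    obtain ⟨h, -⟩ := this
    simpa using h
  have hfilter : (Finset.univ.filter fun π => T.StabilizesColumns π) = {1} := by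
    ext π
    simp only [Finset.mem_filter, Finset.mem_univ, true_and, Finset.mem_singleton]
    constructor
    · intro h
      ext1 i
      exact T.ext_row_col (by rw [hrow, hrow]) (h i)
    · rintro rfl i
      rfl
  rw [polytabloid, hfilter, Finset.sum_singleton, map_one, map_one, Module.End.one_apply,
    Units.val_one, Int.cast_one, one_smul]
  congr 1
  exact funext hrow

theorem spechtSpace_indiscrete (hn : n ≠ 0) :
    spechtSpace k (Nat.Partition.indiscrete n) = Submodule.span k {Finsupp.single 0 1} := by
  have : Nonempty (Tableau (Nat.Partition.indiscrete n)) := nonempty_tableau _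
  rw [spechtSpace]
  congr 1
  rw [← Set.range_const (ι := Tableau (Nat.Partition.indiscrete n))]
  exact congrArg Set.range (funext (polytabloid_indiscrete hn))

theorem specht_indiscrete_apply (hn : n ≠ 0) (g : Equiv.Perm (Fin n))
    (x : spechtSpace k (Nat.Partition.indiscrete n)) :
    specht k (Nat.Partition.indiscrete n) g x = x := by
  obtain ⟨c, hc⟩ := Submodule.mem_span_singleton.1 ((spechtSpace_indiscrete hn).le x.2)
  refine Subtype.ext ?_
  change tabloidRep k n g x.1 = x.1
  rw [← hc, map_smul, tabloidRep_single]
  rfl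

theorem trivials_apply (hn : n ≠ 0) {m : ℕ} (g : Equiv.Perm (Fin n))
    (x : DirectSum (Fin m) fun _ => spechtSpace k (Nat.Partition.indiscrete n)) :
    trivials k n m g x = x := by
  have : trivials k n m g = DirectSum.lmap fun _ => LinearMap.id := by
    rw [trivials, Representation.directSum_apply]
    congr 1
    funext _
    exact LinearMap.ext (specht_indiscrete_apply hn g)
  rw [this, DirectSum.lmap_id]
  rfl

theorem nonempty_linearEquiv_trivials (hn : n ≠ 0) (V : Type*) [AddCommGroup V] [Module k V]
    [FiniteDimensional k V] : Nonempty (V ≃ₗ[k]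
      DirectSum (Fin (Module.finrank k V)) fun _ => spechtSpace k (Nat.Partition.indiscrete n)) := by
  have := finiteDimensional_spechtSpace (k := k) (lam := Nat.Partition.indiscrete n)
  have := free_spechtSpace (k := k) (lam := Nat.Partition.indiscrete n)
  have h1 : Module.finrank k (spechtSpace k (Nat.Partition.indiscrete n)) = 1 := by
    rw [spechtSpace_indiscrete hn]
    exact finrank_span_singleton (by simp)
  let e : k ≃ₗ[k] spechtSpace k (Nat.Partition.indiscrete n) :=
    LinearEquiv.ofFinrankEq _ _ (by rw [h1, Module.finrank_self])
  exact ⟨(Module.finBasis k V).equivFun ≪≫ₗ LinearEquiv.piCongrRight (fun _ => e) ≪≫ₗ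
    (DirectSum.linearEquivFunOnFintype k (Fin (Module.finrank k V))
      fun _ => spechtSpace k (Nat.Partition.indiscrete n)).symm⟩

theorem nonempty_equiv_trivials (hn : n ≠ 0) {V : Type*} [AddCommGroup V] [Module k V]
    [FiniteDimensional k V] (ρ : Representation k (Equiv.Perm (Fin n)) V)
    (h : ∀ i j, i ≠ j → antiSpace ρ i j = ⊥) :
    Nonempty (ρ.Equiv (trivials k n (Module.finrank k V))) := by
  obtain ⟨e⟩ := nonempty_linearEquiv_trivials (k := k) hn V
  refine ⟨Representation.Equiv.mk e fun g => LinearMap.ext fun v => ?_⟩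
  have hv : ρ g v = v := by
    refine mem_invariants_of_swap (fun i j hij => ?_) g
    have := sub_mem_antiSpace (ρ := ρ) i j v
    rw [h i j hij, Submodule.mem_bot, sub_eq_zero] at this
    exact this.symm
  rw [LinearMap.comp_apply, LinearMap.comp_apply, hv, trivials_apply hn]

end Trivials

/-! ### Recognizing a Specht module inside a reflection representation -/

section Embedding

variable {k : Type*} [Field k] [CharZero k] {n : ℕ} {lam : n.Partition}
  {V : Type*} [AddCommGroup V] [Module k V] [FiniteDimensional k V]
  {ρ : Representation k (Equiv.Perm (Fin n)) V}

/-- This is the common engine of the three nontrivial cases. By `hu` the tabloid of `T` can be sent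
to `u`; by `hne` the polytabloid of `T` survives; by `hline` the transposition `(a b)` acts on the
Specht module as a reflection along that polytabloid. -/
theorem IsReflectionRep.nonempty_equiv_specht_prod (hρ : IsReflectionRep ρ)
    (hlam : (1, 0) ∈ diagram lam) (T : Tableau lam) {a b : Fin n} (hab : a ≠ b)
    (hcol : T.col a = T.col b)
    (hline : ∀ T' : Tableau lam, ∃ c : k,
      polytabloid k T' - tabloidRep k n (Equiv.swap a b) (polytabloid k T') = c • polytabloid k T)
    (u : V) (hu : ∀ g : Equiv.Perm (Fin n), (∀ i, T.row (g i) = T.row i) → ρ g u = u)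
    (hne : ∑ π : Equiv.Perm (Fin n) with T.StabilizesColumns π,
      ((Equiv.Perm.sign π : ℤ) : k) • ρ π u ≠ 0) :
    ∃ m, Module.finrank k (spechtSpace k lam) + m = Module.finrank k V ∧
      Nonempty (ρ.Equiv ((specht k lam).prod (trivials k n m))) := by
  have hn : n ≠ 0 := (Nat.zero_lt_of_lt a.2).ne'
  obtain ⟨F, hF, hFu⟩ := exists_equivariant_map ρ T.row u hu
  let F' : spechtSpace k lam →ₗ[k] V := F ∘ₗ (spechtSpace k lam).subtype
  have hF' : ∀ g x, F' (specht k lam g x) = ρ g (F' x) := fun g x => hF g x.1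
  let β : spechtSpace k lam := ⟨polytabloid k T, polytabloid_mem T⟩
  have hβ : specht k lam (Equiv.swap a b) β = -β :=
    Subtype.ext (tabloidRep_swap_polytabloid T hab hcol)
  have hFβ : F' β ≠ 0 := by
    change F (polytabloid k T) ≠ 0
    rw [polytabloid, map_sum]
    simpa only [map_smul, hF, hFu] using hne
  have hl : ∀ x, ∃ c : k, x - specht k lam (Equiv.swap a b) x = c • β := by
    intro x
    have h1 : spechtSpace k lam ≤ (Submodule.span k {polytabloid k T}).comap
        (1 - tabloidRep k n (Equiv.swap a b)) := by
      refine Submodule.span_le.2 ?_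
      rintro _ ⟨T', rfl⟩
      obtain ⟨c, hc⟩ := hline T'
      exact Submodule.mem_span_singleton.2 ⟨c, hc.symm⟩
    obtain ⟨c, hc⟩ := Submodule.mem_span_singleton.1 (h1 x.2)
    exact ⟨c, Subtype.ext hc.symm⟩
  have hS := specht_invariants_eq_bot (k := k) hlam
  obtain ⟨hinj, hN⟩ := hρ.injective_and_le_range F' hF' hS hab hβ hFβ hl
  obtain ⟨e, he⟩ := exists_linearEquiv_prod_of_injective F' hF' hinj hS hN
  have := finiteDimensional_spechtSpace (k := k) (lam := lam)
  have := free_spechtSpace (k := k) (lam := lam)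
  obtain ⟨e'⟩ := nonempty_linearEquiv_trivials (k := k) hn ρ.invariants
  refine ⟨Module.finrank k ρ.invariants, ?_, ⟨(Representation.Equiv.mk
    ((LinearEquiv.prodCongr (LinearEquiv.refl k _) e'.symm) ≪≫ₗ e) fun g => ?_).symm⟩⟩
  · rw [← LinearEquiv.finrank_eq e, Module.finrank_prod]
  · refine LinearMap.ext fun ⟨x, u⟩ => ?_
    change e (specht k lam g x, e'.symm (trivials k n _ g u)) = ρ g (e (x, e'.symm u))
    rw [trivials_apply hn, he]

end Embedding

/-! ### The three shapes that occur -/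

section Shapes

variable {k : Type*} [Field k] {n : ℕ} {lam : n.Partition}

theorem exists_tableau {p q : ℕ × ℕ} (hp : p ∈ diagram lam) (hq : q ∈ diagram lam) (hpq : p ≠ q)
    {a b : Fin n} (hab : a ≠ b) :
    ∃ T : Tableau lam, (T.row a = p.1 ∧ T.col a = p.2) ∧ T.row b = q.1 ∧ T.col b = q.2 := by
  obtain ⟨T⟩ := nonempty_tableau lam
  obtain ⟨a', ha⟩ := T.exists_entry hp
  obtain ⟨b', hb⟩ := T.exists_entry hq
  have hab' : a' ≠ b' := by
    rintro rfl
    exact hpq (Prod.ext (ha.1.symm.trans hb.1) (ha.2.symm.trans hb.2))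
  obtain ⟨g, rfl, rfl⟩ := exists_perm_apply_eq hab' hab
  refine ⟨T.act g, ?_⟩
  simpa [Tableau.row, Tableau.col, Tableau.act] using ⟨ha, hb⟩

/-- The tabloid of a set of entries in row `1`, the others being in row `0`. -/
noncomputable def indicatorTabloid (k : Type*) [Field k] (s : Finset (Fin n)) : (Fin n → ℕ) →₀ k :=
  Finsupp.single (fun i => if i ∈ s then 1 else 0) 1

theorem tabloidRep_indicatorTabloid (g : Equiv.Perm (Fin n)) (s : Finset (Fin n)) :
    tabloidRep k n g (indicatorTabloid k s) = indicatorTabloid k (s.image g) := by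
  rw [indicatorTabloid, tabloidRep_single, indicatorTabloid]
  congr 1
  funext i
  have : g⁻¹ i ∈ s ↔ i ∈ s.image g := by
    rw [Finset.mem_image]
    exact ⟨fun h => ⟨_, h, by simp⟩, by rintro ⟨j, hj, rfl⟩; simpa using hj⟩
  simp only [Function.comp_apply, this]

theorem linearIndependent_indicatorTabloid :
    LinearIndependent k (indicatorTabloid k : Finset (Fin n) → _) := by
  refine (Finsupp.linearIndependent_single_one k (Fin n → ℕ)).comp
    (fun (s : Finset (Fin n)) i => if i ∈ s then 1 else 0) ?_
  intro s t h
  ext i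
  have := congrFun h i
  by_cases hs : i ∈ s <;> by_cases ht : i ∈ t <;> simp_all

/-! ### The alternating representation -/

section Alternating

variable (hlam : lam.parts = Multiset.replicate n 1)
include hlam

theorem mem_diagram_replicate {c : ℕ × ℕ} : c ∈ diagram lam ↔ c.1 < n ∧ c.2 = 0 := by
  rw [mem_diagram_iff (l := List.replicate n 1) (List.pairwise_replicate.2 (Or.inr le_rfl))
    (by rw [hlam, Multiset.coe_replicate])]
  simp

theorem Tableau.col_replicate (T : Tableau lam) (i : Fin n) : T.col i = 0 :=
  ((mem_diagram_replicate hlam).1 (T.mem i)).2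

variable [CharZero k] {V : Type*} [AddCommGroup V] [Module k V] [FiniteDimensional k V]
  {ρ : Representation k (Equiv.Perm (Fin n)) V}

theorem IsReflectionRep.nonempty_equiv_alternating (hρ : IsReflectionRep ρ) {a b : Fin n}
    (hab : a ≠ b) {α : V} (h0 : α ≠ 0)
    (hα : ∀ g : Equiv.Perm (Fin n), ρ g α = ((Equiv.Perm.sign g : ℤ) : k) • α) :
    ∃ m, Module.finrank k (spechtSpace k lam) + m = Module.finrank k V ∧
      Nonempty (ρ.Equiv ((specht k lam).prod (trivials k n m))) := by
  obtain ⟨T⟩ := nonempty_tableau lam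
  have hcol : ∀ (T : Tableau lam) i j, T.col i = T.col j := fun T i j => by
    rw [T.col_replicate hlam, T.col_replicate hlam]
  have hn : 1 < n := by
    have := a.2; have := b.2; have := Fin.val_ne_of_ne hab; omega
  refine hρ.nonempty_equiv_specht_prod ((mem_diagram_replicate hlam).2 ⟨hn, rfl⟩) T hab
    (hcol T a b) (fun T' => ?_) α (fun g hg => ?_) ?_
  · obtain ⟨σ, rfl⟩ := T.exists_act_eq T'
    rw [tabloidRep_swap_polytabloid _ hab (hcol _ a b), ← tabloidRep_polytabloid,
      tabloidRep_polytabloid_of_stabilizesColumns T (fun i => hcol T _ _), sub_neg_eq_add,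
      ← add_smul]
    exact ⟨_, rfl⟩
  · have : g = 1 := Equiv.ext fun i => T.ext_row_col (hg i) (hcol T _ _)
    rw [this, map_one, Module.End.one_apply]
  -- The two signs cancel, so the antisymmetrizer multiplies `α` by the order of the column
  -- stabilizer.
  · have : ∀ π : Equiv.Perm (Fin n), ((Equiv.Perm.sign π : ℤ) : k) • ρ π α = α := by
      intro π
      rw [hα, smul_smul, ← Int.cast_mul, ← Units.val_mul, Int.units_mul_self, Units.val_one,
        Int.cast_one, one_smul]
    rw [Finset.sum_congr rfl fun π _ => this π, Finset.sum_const, ← Nat.cast_smul_eq_nsmul k]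
    refine smul_ne_zero (Nat.cast_ne_zero.2 (Finset.card_ne_zero.2 ⟨1, ?_⟩)) h0
    exact Finset.mem_filter.2 ⟨Finset.mem_univ _, fun i => hcol T _ _⟩

end Alternating

/-! ### The standard representation -/

section Standard

variable (hlam : lam.parts = {n - 1, 1}) (hn : 2 ≤ n)
include hlam hn

theorem mem_diagram_standard {c : ℕ × ℕ} :
    c ∈ diagram lam ↔ c.1 = 0 ∧ c.2 < n - 1 ∨ c = (1, 0) := by
  have hl : [n - 1, 1].Pairwise (· ≥ ·) := by
    simp; omega
  rw [mem_diagram_iff hl (by rw [hlam]; rfl)]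
  obtain ⟨i, j⟩ := c
  rcases i with _ | _ | i <;> simp

variable {T : Tableau lam} {a b : Fin n} (ha : T.row a = 1 ∧ T.col a = 0)
  (hb : T.row b = 0 ∧ T.col b = 0)
include ha

theorem Tableau.row_standard : T.row = fun i => if i ∈ ({a} : Finset (Fin n)) then 1 else 0 := by
  funext i
  simp only [Finset.mem_singleton]
  split_ifs with h
  · rw [h, ha.1]
  · rcases (mem_diagram_standard hlam hn).1 (T.mem i) with h' | h'
    · exact h'.1
    · exact absurd (T.ext_row_col ((congrArg Prod.fst h').trans ha.1.symm)
        ((congrArg Prod.snd h').trans ha.2.symm)) h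

include hb

theorem Tableau.filter_stabilizesColumns_standard :
    (Finset.univ.filter fun π => T.StabilizesColumns π) = {1, Equiv.swap a b} := by
  have hrow := T.row_standard hlam hn ha
  have hcol : ∀ i, T.col i = 0 → i = a ∨ i = b := by
    intro i hi
    by_contra! h
    refine h.2 (T.ext_row_col ?_ (hi.trans hb.2.symm))
    rw [hb.1, hrow]
    simp [h.1]
  have hab : a ≠ b := by
    rintro rfl
    exact one_ne_zero (ha.1.symm.trans hb.1)
  ext π
  simp only [Finset.mem_filter, Finset.mem_univ, true_and, Finset.mem_insert,
    Finset.mem_singleton]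
  constructor
  · intro h
    have hfix : ∀ i, i ≠ a → i ≠ b → π i = i := by
      intro i hia hib
      have h1 : π i ≠ a := fun h1 => by
        have := h i
        rw [h1, ha.2] at this
        rcases hcol i this.symm with h | h <;> contradiction
      refine T.ext_row_col ?_ (h i)
      rw [hrow]
      simp [hia, h1]
    have h2 : π a = a ∨ π a = b := hcol _ ((h a).trans ha.2)
    have h3 : π b = a ∨ π b = b := hcol _ ((h b).trans hb.2)
    have h4 : π a ≠ π b := π.injective.ne hab
    rcases h2 with h2 | h2
    · left
      have h3 : π b = b := h3.resolve_left fun h => h4 (h2.trans h.symm)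
      ext1 i
      by_cases hia : i = a
      · rw [hia, h2]; rfl
      by_cases hib : i = b
      · rw [hib, h3]; rfl
      rw [hfix i hia hib]; rfl
    · right
      have h3 : π b = a := h3.resolve_right fun h => h4 (h2.trans h.symm)
      ext1 i
      by_cases hia : i = a
      · rw [hia, h2, Equiv.swap_apply_left]
      by_cases hib : i = b
      · rw [hib, h3, Equiv.swap_apply_right]
      rw [hfix i hia hib, Equiv.swap_apply_of_ne_of_ne hia hib]
  · rintro (rfl | rfl)
    · exact fun i => rfl
    · exact T.stabilizesColumns_swap (ha.2.trans hb.2.symm)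

theorem Tableau.sum_stabilizesColumns_standard {M : Type*} [AddCommGroup M] [Module k M]
    (f : Equiv.Perm (Fin n) → M) :
    ∑ π : Equiv.Perm (Fin n) with T.StabilizesColumns π, ((Equiv.Perm.sign π : ℤ) : k) • f π =
      f 1 - f (Equiv.swap a b) := by
  have hab : a ≠ b := by
    rintro rfl
    exact one_ne_zero (ha.1.symm.trans hb.1)
  have h1 : (1 : Equiv.Perm (Fin n)) ≠ Equiv.swap a b := by
    intro h
    exact hab (by simpa using DFunLike.congr_fun h a)
  rw [T.filter_stabilizesColumns_standard hlam hn ha hb, Finset.sum_pair h1,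
    Equiv.Perm.sign_swap hab]
  simp [sub_eq_add_neg]

theorem polytabloid_standard :
    polytabloid k T = indicatorTabloid k {a} - indicatorTabloid k {b} := by
  have h : Finsupp.single T.row 1 = indicatorTabloid k {a} := by
    rw [T.row_standard hlam hn ha]; rfl
  rw [polytabloid, T.sum_stabilizesColumns_standard hlam hn ha hb, h,
    tabloidRep_indicatorTabloid, tabloidRep_indicatorTabloid]
  simp

omit ha hb

/-- Adjoining a single tabloid to the differences of tabloids recovers all `n` of them. -/
theorem sub_one_le_finrank_spechtSpace_standard :
    n - 1 ≤ Module.finrank k (spechtSpace k lam) := by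
  have := finiteDimensional_spechtSpace (k := k) (lam := lam)
  let b : Fin n := ⟨0, by omega⟩
  have hli : LinearIndependent k fun i : Fin n => indicatorTabloid k ({i} : Finset (Fin n)) :=
    linearIndependent_indicatorTabloid.comp _ (Finset.singleton_injective)
  have h1 := finrank_span_eq_card hli
  rw [Fintype.card_fin] at h1
  have h2 : Submodule.span k (Set.range fun i : Fin n => indicatorTabloid k ({i} : Finset (Fin n)))
      ≤ spechtSpace k lam ⊔ Submodule.span k {indicatorTabloid k {b}} := by
    refine Submodule.span_le.2 ?_
    rintro _ ⟨i, rfl⟩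
    have hmem : indicatorTabloid k {i} - indicatorTabloid k {b} ∈ spechtSpace k lam := by
      by_cases hib : i = b
      · rw [hib, sub_self]; exact Submodule.zero_mem _
      · obtain ⟨T, hT1, hT2⟩ := exists_tableau (lam := lam)
          ((mem_diagram_standard hlam hn).2 (Or.inr rfl : _ ∨ ((1, 0) : ℕ × ℕ) = (1, 0)))
          ((mem_diagram_standard hlam hn (c := (0, 0))).2 (Or.inl ⟨rfl, show 0 < n - 1 by omega⟩))
          (by simp) hib
        rw [← polytabloid_standard hlam hn hT1 hT2]
        exact polytabloid_mem T
    have := Submodule.add_mem_sup hmem (Submodule.mem_span_singleton_self (R := k)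
      (indicatorTabloid k {b}))
    rwa [sub_add_cancel] at this
  have h3 := Submodule.finrank_mono h2
  have h4 := Submodule.finrank_add_le_finrank_add_finrank (spechtSpace k lam)
    (Submodule.span k {indicatorTabloid k {b}})
  have h5 : Module.finrank k (Submodule.span k {indicatorTabloid k ({b} : Finset (Fin n))}) ≤ 1 := by
    simpa using finrank_span_le_card (R := k) {indicatorTabloid k ({b} : Finset (Fin n))}
  omega

variable [CharZero k] {V : Type*} [AddCommGroup V] [Module k V] [FiniteDimensional k V]
  {ρ : Representation k (Equiv.Perm (Fin n)) V}

theorem IsReflectionRep.nonempty_equiv_standard (hρ : IsReflectionRep ρ) {a b : Fin n}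
    (hab : a ≠ b) (u : V) (hu : ∀ g : Equiv.Perm (Fin n), g a = a → ρ g u = u)
    (hne : u - ρ (Equiv.swap a b) u ≠ 0) :
    ∃ m, Module.finrank k (spechtSpace k lam) + m = Module.finrank k V ∧
      Nonempty (ρ.Equiv ((specht k lam).prod (trivials k n m))) := by
  have h10 : (1, 0) ∈ diagram lam := (mem_diagram_standard hlam hn).2 (Or.inr rfl)
  have h00 : (0, 0) ∈ diagram lam := (diagram lam).up_left_mem (Nat.zero_le 1) le_rfl h10
  obtain ⟨T, hT1, hT2⟩ := exists_tableau h10 h00 (by simp) hab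
  refine hρ.nonempty_equiv_specht_prod h10 T hab (hT1.2.trans hT2.2.symm) (fun T' => ?_) u
    (fun g hg => ?_) ?_
  · obtain ⟨a', ha'⟩ := T'.exists_entry h10
    obtain ⟨b', hb'⟩ := T'.exists_entry h00
    have key : ∀ x, ∃ c : k, indicatorTabloid k {x} - indicatorTabloid k {Equiv.swap a b x} =
        c • (indicatorTabloid k {a} - indicatorTabloid k {b}) := by
      intro x
      by_cases hxa : x = a
      · exact ⟨1, by rw [hxa, Equiv.swap_apply_left, one_smul]⟩
      by_cases hxb : x = b
      · exact ⟨-1, by rw [hxb, Equiv.swap_apply_right, neg_one_smul, neg_sub]⟩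
      · exact ⟨0, by rw [Equiv.swap_apply_of_ne_of_ne hxa hxb, sub_self, zero_smul]⟩
    obtain ⟨c, hc⟩ := key a'
    obtain ⟨d, hd⟩ := key b'
    refine ⟨c - d, ?_⟩
    rw [polytabloid_standard hlam hn ha' hb', polytabloid_standard hlam hn hT1 hT2, map_sub,
      tabloidRep_indicatorTabloid, tabloidRep_indicatorTabloid, Finset.image_singleton,
      Finset.image_singleton, sub_smul, ← hc, ← hd]
    abel
  · refine hu g (by_contra fun h => ?_)
    have := hg a
    rw [T.row_standard hlam hn hT1] at this
    simp [h] at this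
  · rw [T.sum_stabilizesColumns_standard hlam hn hT1 hT2]
    simpa using hne

end Standard

/-! ### The representation `S^(2,2)` -/

section TwoTwo

variable (hlam : lam.parts = {2, 2})
include hlam

theorem mem_diagram_two_two {c : ℕ × ℕ} : c ∈ diagram lam ↔ c.1 < 2 ∧ c.2 < 2 := by
  rw [mem_diagram_iff (l := [2, 2]) (by simp) (by rw [hlam]; rfl)]
  obtain ⟨i, j⟩ := c
  rcases i with _ | _ | i <;> simp

variable {T : Tableau lam} {a b c d : Fin n} (ha : T.row a = 0 ∧ T.col a = 0)
  (hb : T.row b = 1 ∧ T.col b = 0) (hc : T.row c = 0 ∧ T.col c = 1)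
  (hd : T.row d = 1 ∧ T.col d = 1)
include ha hb hc hd

theorem Tableau.eq_of_two_two (i : Fin n) : i = a ∨ i = b ∨ i = c ∨ i = d := by
  obtain ⟨h1, h2⟩ := (mem_diagram_two_two hlam).1 (T.mem i)
  simp only at h1 h2
  have h1' : T.row i = 0 ∨ T.row i = 1 := by omega
  have h2' : T.col i = 0 ∨ T.col i = 1 := by omega
  rcases h1' with h1 | h1 <;> rcases h2' with h2 | h2
  · exact Or.inl (T.ext_row_col (h1.trans ha.1.symm) (h2.trans ha.2.symm))
  · exact Or.inr (Or.inr (Or.inl (T.ext_row_col (h1.trans hc.1.symm) (h2.trans hc.2.symm))))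
  · exact Or.inr (Or.inl (T.ext_row_col (h1.trans hb.1.symm) (h2.trans hb.2.symm)))
  · exact Or.inr (Or.inr (Or.inr (T.ext_row_col (h1.trans hd.1.symm) (h2.trans hd.2.symm))))

omit hlam in
theorem Tableau.ne_of_two_two : a ≠ b ∧ c ≠ a ∧ c ≠ b ∧ d ≠ a ∧ d ≠ b ∧ c ≠ d := by
  refine ⟨?_, ?_, ?_, ?_, ?_, ?_⟩ <;> (rintro rfl; omega)

theorem Tableau.row_two_two :
    T.row = fun i => if i ∈ ({b, d} : Finset (Fin n)) then 1 else 0 := by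
  obtain ⟨hab, hca, hcb, hda, hdb, hcd⟩ := Tableau.ne_of_two_two ha hb hc hd
  funext i
  rcases T.eq_of_two_two hlam ha hb hc hd i with rfl | rfl | rfl | rfl
  · simp [ha.1, hab, hda.symm]
  · simp [hb.1]
  · simp [hc.1, hcb, hcd]
  · simp [hd.1]

theorem Tableau.filter_stabilizesColumns_two_two :
    (Finset.univ.filter fun π => T.StabilizesColumns π) =
      {1, Equiv.swap a b, Equiv.swap c d, Equiv.swap a b * Equiv.swap c d} := by
  obtain ⟨hab, hca, hcb, hda, hdb, hcd⟩ := Tableau.ne_of_two_two ha hb hc hd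
  have hall := T.eq_of_two_two hlam ha hb hc hd
  have hcol0 : ∀ i, T.col i = 0 → i = a ∨ i = b := by
    intro i hi
    rcases hall i with rfl | rfl | rfl | rfl <;> simp_all
  have hcol1 : ∀ i, T.col i = 1 → i = c ∨ i = d := by
    intro i hi
    rcases hall i with rfl | rfl | rfl | rfl <;> simp_all
  have hs := T.stabilizesColumns_swap (ha.2.trans hb.2.symm)
  have ht := T.stabilizesColumns_swap (hc.2.trans hd.2.symm)
  ext π
  simp only [Finset.mem_filter, Finset.mem_univ, true_and, Finset.mem_insert,
    Finset.mem_singleton]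
  constructor
  · intro h
    have ext4 : ∀ τ : Equiv.Perm (Fin n), π a = τ a → π b = τ b → π c = τ c → π d = τ d →
        π = τ := by
      intro τ h1 h2 h3 h4
      ext1 i
      rcases hall i with rfl | rfl | rfl | rfl <;> assumption
    have pab := π.injective.ne hab
    have pcd := π.injective.ne hcd
    rcases hcol0 _ ((h a).trans ha.2) with h1 | h1 <;>
      rcases hcol0 _ ((h b).trans hb.2) with h2 | h2 <;>
      rcases hcol1 _ ((h c).trans hc.2) with h3 | h3 <;>
      rcases hcol1 _ ((h d).trans hd.2) with h4 | h4 <;>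
      first
        | exact absurd (h1.trans h2.symm) pab
        | exact absurd (h3.trans h4.symm) pcd
        | skip
    · exact Or.inl (ext4 _ h1 h2 h3 h4)
    · refine Or.inr (Or.inr (Or.inl (ext4 _ ?_ ?_ ?_ ?_))) <;>
        simp [Equiv.swap_apply_of_ne_of_ne, *, Ne.symm]
    · refine Or.inr (Or.inl (ext4 _ ?_ ?_ ?_ ?_)) <;>
        simp [Equiv.swap_apply_of_ne_of_ne, *]
    · refine Or.inr (Or.inr (Or.inr (ext4 _ ?_ ?_ ?_ ?_))) <;>
        simp [Equiv.swap_apply_of_ne_of_ne, *, Ne.symm]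
  · rintro (rfl | rfl | rfl | rfl)
    · exact fun i => rfl
    · exact hs
    · exact ht
    · exact fun i => (hs _).trans (ht i)

theorem Tableau.sum_stabilizesColumns_two_two {M : Type*} [AddCommGroup M] [Module k M]
    (f : Equiv.Perm (Fin n) → M) :
    ∑ π : Equiv.Perm (Fin n) with T.StabilizesColumns π, ((Equiv.Perm.sign π : ℤ) : k) • f π =
      f 1 - f (Equiv.swap a b) - f (Equiv.swap c d) +
        f (Equiv.swap a b * Equiv.swap c d) := by
  obtain ⟨hab, hca, hcb, hda, hdb, hcd⟩ := Tableau.ne_of_two_two ha hb hc hd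
  have h1 : (1 : Equiv.Perm (Fin n)) ≠ Equiv.swap a b := fun h =>
    hab (by simpa using DFunLike.congr_fun h a)
  have h2 : (1 : Equiv.Perm (Fin n)) ≠ Equiv.swap c d := fun h =>
    hcd (by simpa using DFunLike.congr_fun h c)
  have h3 : Equiv.swap a b ≠ Equiv.swap c d := fun h => hab.symm (by
    simpa [Equiv.swap_apply_of_ne_of_ne hca.symm hda.symm] using DFunLike.congr_fun h a)
  have h4 : (1 : Equiv.Perm (Fin n)) ≠ Equiv.swap a b * Equiv.swap c d := fun h =>
    hab (by simpa [Equiv.swap_apply_of_ne_of_ne hca.symm hda.symm] using DFunLike.congr_fun h a)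
  have h5 : Equiv.swap a b ≠ Equiv.swap a b * Equiv.swap c d := fun h => h2 (left_eq_mul.1 h).symm
  have h6 : Equiv.swap c d ≠ Equiv.swap a b * Equiv.swap c d := fun h => h1 (right_eq_mul.1 h).symm
  rw [T.filter_stabilizesColumns_two_two hlam ha hb hc hd,
    Finset.sum_insert (by simp [h1, h2, h4]), Finset.sum_insert (by simp [h3, h5]),
    Finset.sum_pair h6, Equiv.Perm.sign_mul, Equiv.Perm.sign_swap hab, Equiv.Perm.sign_swap hcd]
  simp
  abel

theorem polytabloid_two_two :
    polytabloid k T = indicatorTabloid k {b, d} - indicatorTabloid k {a, d} -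
      indicatorTabloid k {b, c} + indicatorTabloid k {a, c} := by
  obtain ⟨hab, hca, hcb, hda, hdb, hcd⟩ := Tableau.ne_of_two_two ha hb hc hd
  have h : Finsupp.single T.row 1 = indicatorTabloid k {b, d} := by
    rw [T.row_two_two hlam ha hb hc hd]; rfl
  rw [polytabloid, T.sum_stabilizesColumns_two_two hlam ha hb hc hd, h]
  simp only [tabloidRep_indicatorTabloid, Finset.image_insert, Finset.image_singleton,
    Equiv.Perm.mul_apply, Equiv.swap_apply_right, Equiv.Perm.one_apply,
    Equiv.swap_apply_of_ne_of_ne hda hdb, Equiv.swap_apply_of_ne_of_ne hcb.symm hdb.symm,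
    Equiv.swap_apply_of_ne_of_ne hca hcb]

omit ha hb hc hd

theorem exists_entries_two_two (T : Tableau lam) : ∃ a b c d, (T.row a = 0 ∧ T.col a = 0) ∧
    (T.row b = 1 ∧ T.col b = 0) ∧ (T.row c = 0 ∧ T.col c = 1) ∧ (T.row d = 1 ∧ T.col d = 1) := by
  obtain ⟨a, ha⟩ := T.exists_entry ((mem_diagram_two_two hlam (c := (0, 0))).2 (by simp))
  obtain ⟨b, hb⟩ := T.exists_entry ((mem_diagram_two_two hlam (c := (1, 0))).2 (by simp))
  obtain ⟨c, hc⟩ := T.exists_entry ((mem_diagram_two_two hlam (c := (0, 1))).2 (by simp))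
  obtain ⟨d, hd⟩ := T.exists_entry ((mem_diagram_two_two hlam (c := (1, 1))).2 (by simp))
  exact ⟨a, b, c, d, ha, hb, hc, hd⟩

end TwoTwo

end Shapes

/-! ### Reflections and dimension for `S^(2,2)` -/

section TwoTwo

variable {k : Type*} [Field k] {n : ℕ} {lam : n.Partition}

/-- Reading `D i j` as `x_i x_j`, a polytabloid becomes `(x_y - x_x)(x_w - x_z)`. The assertion is
that `1 - (a b)` sends it to a multiple of `(x_b - x_a)(x_d - x_c)`: the factor is `±2` if the
columns are `{a, b}` and `{c, d}`, and `±1` otherwise. The proof runs through the `24` fillings. -/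
theorem exists_smul_of_symmetric {ι M : Type*} [AddCommGroup M] [Module k M] (D : ι → ι → M)
    (hD : ∀ x y, D x y = D y x) (s : ι → ι) {a b c d : ι} (sa : s a = b) (sb : s b = a)
    (sc : s c = c) (sd : s d = d) {x y z w : ι} (hx : x = a ∨ x = b ∨ x = c ∨ x = d)
    (hy : y = a ∨ y = b ∨ y = c ∨ y = d) (hz : z = a ∨ z = b ∨ z = c ∨ z = d)
    (hw : w = a ∨ w = b ∨ w = c ∨ w = d) (hxy : x ≠ y) (hzx : z ≠ x) (hzy : z ≠ y) (hwx : w ≠ x)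
    (hwy : w ≠ y) (hzw : z ≠ w) :
    ∃ e : k, D y w - D x w - D y z + D x z -
      (D (s y) (s w) - D (s x) (s w) - D (s y) (s z) + D (s x) (s z)) =
      e • (D b d - D a d - D b c + D a c) := by
  have h1 := hD b a
  have h2 := hD c a
  have h3 := hD d a
  have h4 := hD c b
  have h5 := hD d b
  have h6 := hD d c
  rcases hx with rfl | rfl | rfl | rfl <;> rcases hy with rfl | rfl | rfl | rfl <;>
    first
    | exact absurd rfl hxy
    | skip
  all_goals
    rcases hz with rfl | rfl | rfl | rfl <;>
    first
    | exact absurd rfl hzx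
    | exact absurd rfl hzy
    | skip
  all_goals
    rcases hw with rfl | rfl | rfl | rfl <;>
    first
    | exact absurd rfl hwx
    | exact absurd rfl hwy
    | exact absurd rfl hzw
    | skip
  all_goals
    simp only [sa, sb, sc, sd, h1, h2, h3, h4, h5, h6]
    first
    | exact ⟨1, by module⟩
    | exact ⟨-1, by module⟩
    | exact ⟨2, by module⟩
    | exact ⟨-2, by module⟩

theorem indicatorTabloid_apply_of_ne {s t : Finset (Fin n)} {i : Fin n} (hs : i ∈ s)
    (ht : i ∉ t) : indicatorTabloid k s (fun j => if j ∈ t then 1 else 0) = 0 := by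
  rw [indicatorTabloid, Finsupp.single_apply, if_neg]
  intro h
  simpa [hs, ht] using congrFun h i

theorem indicatorTabloid_apply_self (s : Finset (Fin n)) :
    indicatorTabloid k s (fun j => if j ∈ s then 1 else 0) = 1 := by
  rw [indicatorTabloid, Finsupp.single_eq_same]

variable (hlam : lam.parts = {2, 2})
include hlam

theorem two_le_finrank_spechtSpace_two_two : 2 ≤ Module.finrank k (spechtSpace k lam) := by
  have := finiteDimensional_spechtSpace (k := k) (lam := lam)
  obtain ⟨T⟩ := nonempty_tableau lam
  obtain ⟨a, b, c, d, ha, hb, hc, hd⟩ := exists_entries_two_two hlam T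
  obtain ⟨hab, hca, hcb, hda, hdb, hcd⟩ := Tableau.ne_of_two_two ha hb hc hd
  let x : spechtSpace k lam := ⟨polytabloid k T, polytabloid_mem T⟩
  let y : spechtSpace k lam := ⟨tabloidRep k n (Equiv.swap b c) (polytabloid k T),
    by rw [tabloidRep_polytabloid]; exact polytabloid_mem _⟩
  have hx : x.1 = indicatorTabloid k {b, d} - indicatorTabloid k {a, d} -
      indicatorTabloid k {b, c} + indicatorTabloid k {a, c} :=
    polytabloid_two_two hlam ha hb hc hd
  have hy : y.1 = indicatorTabloid k {c, d} - indicatorTabloid k {a, d} -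
      indicatorTabloid k {c, b} + indicatorTabloid k {a, b} := by
    have : y.1 = tabloidRep k n (Equiv.swap b c) x.1 := rfl
    rw [this, hx]
    simp only [map_add, map_sub, tabloidRep_indicatorTabloid, Finset.image_insert,
      Finset.image_singleton, Equiv.swap_apply_left, Equiv.swap_apply_right,
      Equiv.swap_apply_of_ne_of_ne hdb hcd.symm, Equiv.swap_apply_of_ne_of_ne hab hca.symm]
  -- The tabloid `{b, d}` occurs in `x` and not in `y`, while `{c, d}` occurs in `y`; their
  -- coefficients give `s = 0` and then `t = 0`.
  have hli : LinearIndependent k ![x, y] := by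
    refine (LinearIndependent.pair_iff (M := spechtSpace k lam)).2 ?_
    intro s t hst
    have h1 : s • x.1 + t • y.1 = 0 := congrArg Subtype.val hst
    have h2 := DFunLike.congr_fun h1 fun j => if j ∈ ({b, d} : Finset (Fin n)) then 1 else 0
    have h3 := DFunLike.congr_fun h1 fun j => if j ∈ ({c, d} : Finset (Fin n)) then 1 else 0
    simp only [hx, hy, Finsupp.add_apply, Finsupp.sub_apply, Finsupp.smul_apply,
      Finsupp.zero_apply] at h2 h3
    rw [indicatorTabloid_apply_self,
      indicatorTabloid_apply_of_ne (s := {a, d}) (i := a) (by simp) (by simp [hab, hda.symm]),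
      indicatorTabloid_apply_of_ne (s := {b, c}) (i := c) (by simp) (by simp [hcb, hcd]),
      indicatorTabloid_apply_of_ne (s := {a, c}) (i := a) (by simp) (by simp [hab, hda.symm]),
      indicatorTabloid_apply_of_ne (s := {c, d}) (i := c) (by simp) (by simp [hcb, hcd]),
      indicatorTabloid_apply_of_ne (s := {c, b}) (i := c) (by simp) (by simp [hcb, hcd]),
      indicatorTabloid_apply_of_ne (s := {a, b}) (i := a) (by simp) (by simp [hab, hda.symm])]
      at h2
    have hs : s = 0 := by simpa using h2
    rw [indicatorTabloid_apply_self,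
      indicatorTabloid_apply_of_ne (s := {a, d}) (i := a) (by simp) (by simp [hca.symm, hda.symm]),
      indicatorTabloid_apply_of_ne (s := {c, b}) (i := b) (by simp) (by simp [hcb.symm, hdb.symm]),
      indicatorTabloid_apply_of_ne (s := {a, b}) (i := a) (by simp) (by simp [hca.symm, hda.symm]),
      hs] at h3
    exact ⟨hs, by simpa using h3⟩
  simpa using hli.fintype_card_le_finrank

variable [CharZero k] {V : Type*} [AddCommGroup V] [Module k V] [FiniteDimensional k V]
  {ρ : Representation k (Equiv.Perm (Fin n)) V}

theorem IsReflectionRep.nonempty_equiv_two_two (hρ : IsReflectionRep ρ) {T : Tableau lam}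
    {a b c d : Fin n} (ha : T.row a = 0 ∧ T.col a = 0)
    (hb : T.row b = 1 ∧ T.col b = 0) (hc : T.row c = 0 ∧ T.col c = 1)
    (hd : T.row d = 1 ∧ T.col d = 1) (u : V) (hac : ρ (Equiv.swap a c) u = u)
    (hbd : ρ (Equiv.swap b d) u = u)
    (hne : u - ρ (Equiv.swap a b) u - ρ (Equiv.swap c d) u +
      ρ (Equiv.swap a b) (ρ (Equiv.swap c d) u) ≠ 0) :
    ∃ m, Module.finrank k (spechtSpace k lam) + m = Module.finrank k V ∧
      Nonempty (ρ.Equiv ((specht k lam).prod (trivials k n m))) := by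
  obtain ⟨hab, hca, hcb, hda, hdb, hcd⟩ := Tableau.ne_of_two_two ha hb hc hd
  have hall := T.eq_of_two_two hlam ha hb hc hd
  refine hρ.nonempty_equiv_specht_prod ((mem_diagram_two_two hlam).2 (by simp)) T hab
    (ha.2.trans hb.2.symm) (fun T' => ?_) u (fun g hg => ?_) ?_
  · obtain ⟨x, y, z, w, hx, hy, hz, hw⟩ := exists_entries_two_two hlam T'
    obtain ⟨hxy, hzx, hzy, hwx, hwy, hzw⟩ := Tableau.ne_of_two_two hx hy hz hw
    rw [polytabloid_two_two hlam hx hy hz hw, polytabloid_two_two hlam ha hb hc hd]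
    simp only [map_add, map_sub, tabloidRep_indicatorTabloid, Finset.image_insert,
      Finset.image_singleton]
    exact exists_smul_of_symmetric (fun i j => indicatorTabloid k {i, j})
      (fun i j => by rw [Finset.pair_comm]) (Equiv.swap a b) (Equiv.swap_apply_left a b)
      (Equiv.swap_apply_right a b) (Equiv.swap_apply_of_ne_of_ne hca hcb)
      (Equiv.swap_apply_of_ne_of_ne hda hdb) (hall x) (hall y) (hall z) (hall w)
      hxy hzx hzy hwx hwy hzw
  · have hrow0 : ∀ i, T.row i = 0 → i = a ∨ i = c := by
      intro i hi
      rcases hall i with rfl | rfl | rfl | rfl <;> simp_all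
    have hrow1 : ∀ i, T.row i = 1 → i = b ∨ i = d := by
      intro i hi
      rcases hall i with rfl | rfl | rfl | rfl <;> simp_all
    have ext4 : ∀ τ : Equiv.Perm (Fin n), g a = τ a → g b = τ b → g c = τ c → g d = τ d →
        g = τ := by
      intro τ h1 h2 h3 h4
      ext1 i
      rcases hall i with rfl | rfl | rfl | rfl <;> assumption
    have gac := g.injective.ne hca.symm
    have gbd := g.injective.ne hdb.symm
    rcases hrow0 _ ((hg a).trans ha.1) with h1 | h1 <;>
      rcases hrow0 _ ((hg c).trans hc.1) with h2 | h2 <;>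
      rcases hrow1 _ ((hg b).trans hb.1) with h3 | h3 <;>
      rcases hrow1 _ ((hg d).trans hd.1) with h4 | h4 <;>
      first
        | exact absurd (h1.trans h2.symm) gac
        | exact absurd (h3.trans h4.symm) gbd
        | skip
    · rw [ext4 1 h1 h3 h2 h4, map_one, Module.End.one_apply]
    · rw [ext4 (Equiv.swap b d), hbd] <;> simp [Equiv.swap_apply_of_ne_of_ne, Ne.symm, *]
    · rw [ext4 (Equiv.swap a c), hac] <;> simp [Equiv.swap_apply_of_ne_of_ne, Ne.symm, *]
    · rw [ext4 (Equiv.swap a c * Equiv.swap b d), rep_mul_apply, hbd, hac] <;>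
        simp [Equiv.swap_apply_of_ne_of_ne, Ne.symm, *]
  · rw [T.sum_stabilizesColumns_two_two hlam ha hb hc hd, rep_mul_apply, map_one,
      Module.End.one_apply]
    exact hne

end TwoTwo

/-! ### Classification of the reflection representations and conclusion -/

section Classification

variable {k : Type*} [Field k] [CharZero k] {n : ℕ} {V : Type*} [AddCommGroup V] [Module k V]
  [FiniteDimensional k V] {ρ : Representation k (Equiv.Perm (Fin n)) V}

/-- The classification of the representations of the symmetric group on which every transposition
acts trivially or as a reflection. -/
theorem IsReflectionRep.classification (hρ : IsReflectionRep ρ) (hn : n ≠ 0) :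
    Nonempty (ρ.Equiv (trivials k n (Module.finrank k V))) ∨
    (∃ lam : n.Partition, lam.parts = Multiset.replicate n 1 ∧
      ∃ m, m + 1 ≤ Module.finrank k V ∧
        Nonempty (ρ.Equiv ((specht k lam).prod (trivials k n m)))) ∨
    (∃ lam : n.Partition, lam.parts = {n - 1, 1} ∧ ∃ m, n - 1 + m ≤ Module.finrank k V ∧ 2 ≤ n ∧
      Nonempty (ρ.Equiv ((specht k lam).prod (trivials k n m)))) ∨
    (n = 4 ∧ ∃ lam : n.Partition, lam.parts = {2, 2} ∧ ∃ m, 2 + m ≤ Module.finrank k V ∧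
      Nonempty (ρ.Equiv ((specht k lam).prod (trivials k n m)))) := by
  by_cases htriv : ∀ i j, i ≠ j → antiSpace ρ i j = ⊥
  · exact Or.inl (nonempty_equiv_trivials hn ρ htriv)
  push Not at htriv
  obtain ⟨a, b, hab, hbot⟩ := htriv
  obtain ⟨α, hα, h0⟩ := (Submodule.ne_bot_iff _).1 hbot
  have hn2 : 2 ≤ n := by
    have := a.2; have := b.2; have := Fin.val_ne_of_ne hab; omega
  right
  -- For `n = 2` there is no such `c`, and the sign representation is found in the standard case, as
  -- `S^(1,1)`.
  by_cases hadj : ∃ c, c ≠ a ∧ c ≠ b ∧ α ∈ antiSpace ρ b c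
  · obtain ⟨c, hca, hcb, hc⟩ := hadj
    left
    let lam : n.Partition := ⟨Multiset.replicate n 1, fun h => by
      rw [Multiset.eq_of_mem_replicate h]; exact one_pos, by simp⟩
    obtain ⟨m, hm, he⟩ := hρ.nonempty_equiv_alternating (lam := lam) rfl hab h0
      (apply_eq_sign_smul fun i j hij => hρ.mem_antiSpace_of_adjacent hca hcb h0 hα hc hij)
    refine ⟨lam, rfl, m, ?_, he⟩
    have := one_le_finrank_spechtSpace k lam
    omega
  push Not at hadj
  right
  by_cases hd : ∃ c d, c ≠ a ∧ c ≠ b ∧ d ≠ a ∧ d ≠ b ∧ c ≠ d ∧ α ∈ antiSpace ρ c d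
  · obtain ⟨c, d, hca, hcb, hda, hdb, hcd, hα'⟩ := hd
    right
    obtain ⟨hn4, hall⟩ := hρ.eq_four hab h0 hα hadj hca hcb hda hdb hcd hα'
    let lam : n.Partition := ⟨{2, 2}, fun h => by
      simp at h; omega, by simp [hn4]⟩
    have hlam : lam.parts = {2, 2} := rfl
    obtain ⟨T, ha, hb⟩ := exists_tableau (lam := lam)
      ((mem_diagram_two_two hlam (c := (0, 0))).2 (by simp))
      ((mem_diagram_two_two hlam (c := (1, 0))).2 (by simp)) (by simp) hab
    obtain ⟨c', hc⟩ := T.exists_entry ((mem_diagram_two_two hlam (c := (0, 1))).2 (by simp))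
    obtain ⟨d', hd⟩ := T.exists_entry ((mem_diagram_two_two hlam (c := (1, 1))).2 (by simp))
    obtain ⟨-, hca', hcb', hda', hdb', hcd'⟩ := Tableau.ne_of_two_two ha hb hc hd
    -- The second column of `T` holds `c` and `d` in an unknown order, which does not affect the
    -- line.
    have hα'' : α ∈ antiSpace ρ c' d' := by
      rcases hall c' with h | h | rfl | rfl
      · exact absurd h hca'
      · exact absurd h hcb'
      · rcases hall d' with h | h | h | rfl
        · exact absurd h hda'
        · exact absurd h hdb'
        · exact absurd h.symm hcd'
        · exact hα'
      · rcases hall d' with h | h | rfl | h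
        · exact absurd h hda'
        · exact absurd h hdb'
        · rw [antiSpace_comm]; exact hα'
        · exact absurd h.symm hcd'
    obtain ⟨u, hac, hbd, hne⟩ := hρ.exists_two_two hab h0 hα hadj hca' hcb' hda' hdb' hcd' hα''
    obtain ⟨m, hm, he⟩ := hρ.nonempty_equiv_two_two hlam ha hb hc hd u hac hbd hne
    refine ⟨hn4, lam, hlam, m, ?_, he⟩
    have := two_le_finrank_spechtSpace_two_two (k := k) hlam
    omega
  · left
    push Not at hd
    let lam : n.Partition := ⟨{n - 1, 1}, fun h => by
      simp at h; omega, by simp; omega⟩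
    have hlam : lam.parts = {n - 1, 1} := rfl
    obtain ⟨u, hu, hne⟩ := hρ.exists_standard hab h0 hα hadj hd
    obtain ⟨m, hm, he⟩ := hρ.nonempty_equiv_standard hlam hn2 hab u hu hne
    refine ⟨lam, hlam, m, ?_, hn2, he⟩
    have := sub_one_le_finrank_spechtSpace_standard (k := k) hlam hn2
    omega

end Classification

end SymCI

theorem proposition1 {k : Type*} [Field k] [CharZero k] (n : ℕ)
    (I : Ideal (MvPolynomial (Fin n) k))
    (hhom : SymCI.IsHomogeneousIdeal I)
    (hne : I ≠ ⊥)
    (hstable : SymCI.IsStable I)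
    (hci : SymCI.IsCompleteIntersection I) :
    (∃ m : ℕ, 1 ≤ m ∧ m ≤ n ∧
      Nonempty ((SymCI.genRep I hstable).Equiv (SymCI.trivials k n m))) ∨
    (∃ lam : n.Partition, lam.parts = Multiset.replicate n 1 ∧ ∃ m : ℕ, m + 1 ≤ n ∧
      Nonempty ((SymCI.genRep I hstable).Equiv
        ((SymCI.specht k lam).prod (SymCI.trivials k n m)))) ∨
    (∃ lam : n.Partition, lam.parts = {n - 1, 1} ∧ ∃ m : ℕ, m ≤ 1 ∧
      Nonempty ((SymCI.genRep I hstable).Equiv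
        ((SymCI.specht k lam).prod (SymCI.trivials k n m)))) ∨
    (n = 4 ∧ ∃ lam : n.Partition, lam.parts = {2, 2} ∧ ∃ m : ℕ, m ≤ 2 ∧
      Nonempty ((SymCI.genRep I hstable).Equiv
        ((SymCI.specht k lam).prod (SymCI.trivials k n m)))) := by
  have hfin := SymCI.finite_quotient_irrelevantMul hci
  have hrank := SymCI.finrank_quotient_irrelevantMul_le hhom hci
  have hnt := SymCI.nontrivial_quotient_irrelevantMul hne
  have hpos := Module.finrank_pos (R := k) (M := I.restrictScalars k ⧸ SymCI.irrelevantMul I)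
  have hρ : SymCI.IsReflectionRep (SymCI.genRep I hstable) :=
    SymCI.finrank_range_sub_genRep_swap_le_one hhom hstable hci
  -- Here `n ≠ 0` because `0 < dim W ≤ n`.
  rcases hρ.classification (by omega) with h | ⟨lam, hlam, m, hm, h⟩ | ⟨lam, hlam, m, hm, hn, h⟩ |
    ⟨hn, lam, hlam, m, hm, h⟩
  · exact Or.inl ⟨_, hpos, hrank, h⟩
  · exact Or.inr (Or.inl ⟨lam, hlam, m, by omega, h⟩)
  · exact Or.inr (Or.inr (Or.inl ⟨lam, hlam, m, by omega, h⟩))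
  · exact Or.inr (Or.inr (Or.inr ⟨hn, lam, hlam, m, by omega, h⟩))
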